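/- Let $\mathsf Z$ be a Polish space with its Borel $\sigma$-field and let $d\ge 1$. Let $\mathrm Q$ be a Markov kernel on $\mathsf Z$ with an invariant probability measure $\pi$, and suppose that there is an integer $t_{\mathrm{mix}}\ge 1$ with $$\sup_{z,z'\in\mathsf Z}\tfrac12\|\mathrm Q^k(z,\cdot)-\mathrm Q^k(z',\cdot)\|_{\mathrm{TV}}\le (1/4)^{\lfloor k/t_{\mathrm{mix}}\rfloor}\qquad\text{for all integers }k\ge 1,$$ where $\|\mu\|_{\mathrm{TV}}=|\mu|(\mathsf Z)$. Let $\mathbf A:\mathsf Z\to\mathbb R^{d\times d}$ and $\mathbf b:\mathsf Z\to\mathbb R^d$ be measurable, let $\bar{\mathbf A}\in\mathbb R^{d\times d}$ be such that $-\bar{\mathbf A}$ is Hurwitz (all its eigenvalues have negative real part), let $\bar{\mathbf b}\in\mathbb R^d$, and let $\theta^\star$ be the solution of $\bar{\mathbf A}\theta^\star=\bar{\mathbf b}$. With $\|\cdot\|$ the Euclidean norm on vectors and the spectral norm on matrices, assume that $$\mathrm C_{\mathbf A}=\sup_{z}\|\mathbf A(z)\|\vee\sup_z\|\mathbf A(z)-\bar{\mathbf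 A}\|<\infty,\qquad \int\mathbf A\,d\pi=\bar{\mathbf A},\qquad \int\mathbf b\,d\pi=\bar{\mathbf b},$$ and that the noise $\varepsilon(z)=(\mathbf A(z)-\bar{\mathbf A})\theta^\star-(\mathbf b(z)-\bar{\mathbf b})$ satisfies $\sup_z\|\varepsilon(z)\|<\infty$. Let $Q$ be the unique symmetric positive definite matrix with $\bar{\mathbf A}^\top Q+Q\bar{\mathbf A}=\mathrm I$. Put $\|x\|_Q=(x^\top Qx)^{1/2}$, $\|M\|_Q=\max_{\|x\|_Q=1}\|Mx\|_Q$, $a=\|Q\|^{-1}/2$, $\kappa_Q=\lambda_{\max}(Q)/\lambda_{\min}(Q)$, and $$\alpha_\infty=\bigl(\tfrac12\|\bar{\mathbf A}\|_Q^{-2}\|Q\|^{-1}\bigr)\wedge\|Q\|,\qquad N=\lceil 8\kappa_Q^{1/2}\mathrm C_{\mathbf A}/a\rceil,$$ $$\alpha_\infty^{(\mathrm M)}=\Bigl[\alpha_\infty\wedge\kappa_Q^{-1/2}\mathrm C_{\mathbf A}^{-1}\wedge\frac{a}{6\mathrm e\,\kappa_Q\mathrm C_{\mathbf A}}\Bigr]N^{-1},\qquad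 \mathrm C_\Gamma=4\bigl(\kappa_Q^{1/2}\mathrm C_{\mathbf A}+a/6\bigr)^2N,\qquad \alpha_{q,\infty}^{(\mathrm M)}=\alpha_\infty^{(\mathrm M)}\wedge\frac{a}{12\,\mathrm C_\Gamma\,q}.$$ For $\alpha>0$ let $\mathrm P_\alpha$ be the Markov kernel on $\mathbb R^d\times\mathsf Z$ of the joint chain $(\theta_k^{(\alpha)},Z_{k+1})$, given for bounded measurable $f$ by $$\mathrm P_\alpha f(\theta,z)=\int_{\mathsf Z}\mathrm Q(z,dz')\,f\bigl((\mathrm I-\alpha\mathbf A(z'))\theta+\alpha\mathbf b(z'),\,z'\bigr).$$ **Theorem.** Let $q\ge 2$ be real. For every $\alpha\in\bigl(0,(\alpha_{q,\infty}^{(\mathrm M)}\wedge a^{-1})\,t_{\mathrm{mix}}^{-1}\bigr)$, the kernel $\mathrm P_\alpha$ admits a unique invariant probability measure $\Pi_\alpha$ on $\mathbb R^d\times\mathsf Z$, and $\int\|\theta-\theta^\star\|\,\Pi_\alpha(d\theta,dz)<\infty$. -/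

import Mathlib

open MeasureTheory ProbabilityTheory Filter Topology
open scoped Matrix ENNReal

namespace LSA

/-- A real square matrix is Hurwitz if all its complex eigenvalues have negative real part. -/
def IsHurwitz {d : ℕ} (M : Matrix (Fin d) (Fin d) ℝ) : Prop :=
  ∀ μ ∈ spectrum ℂ (M.map (algebraMap ℝ ℂ)), μ.re < 0

section Lyapunov

variable {d : ℕ}

theorem isUnit_map_complex_iff (M : Matrix (Fin d) (Fin d) ℝ) :
    IsUnit (M.map (algebraMap ℝ ℂ)) ↔ IsUnit M := by
  rw [Matrix.isUnit_iff_isUnit_det, Matrix.isUnit_iff_isUnit_det, ← RingHom.mapMatrix_apply,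
    ← RingHom.map_det, isUnit_iff_ne_zero, isUnit_iff_ne_zero, map_ne_zero]

theorem isUnit_one_add {A : Matrix (Fin d) (Fin d) ℝ} (hA : IsHurwitz (-A)) :
    IsUnit (1 + A) := by
  rw [← isUnit_map_complex_iff]
  by_contra h
  have : (1 : ℂ) ∈ spectrum ℂ ((-A).map (algebraMap ℝ ℂ)) := by
    rw [spectrum.mem_iff]
    convert h using 2
    ext i j
    simp [Matrix.map_apply, Matrix.one_apply]
    split_ifs <;> simp
  have := hA _ this
  norm_num at this

theorem cayley_spectrum {A : Matrix (Fin d) (Fin d) ℝ} (hA : IsHurwitz (-A)) (μ : ℂ)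
    (hμ : μ ∈ spectrum ℂ (((1 - A) * (1 + A)⁻¹).map (algebraMap ℝ ℂ))) : ‖μ‖ < 1 := by
  set N := (1 + A).map (algebraMap ℝ ℂ) with hN
  set B := A.map (algebraMap ℝ ℂ) with hB
  have hu := isUnit_one_add hA
  have hdet : IsUnit (1 + A).det := (Matrix.isUnit_iff_isUnit_det _).1 hu
  have hNu : IsUnit N := (isUnit_map_complex_iff _).2 hu
  have hN1 : N = 1 + B := by
    rw [hN, hB, ← RingHom.mapMatrix_apply, map_add, map_one]; rfl
  have key : (algebraMap ℂ (Matrix (Fin d) (Fin d) ℂ) μ -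
      ((1 - A) * (1 + A)⁻¹).map (algebraMap ℝ ℂ)) * N = (μ - 1) • 1 + (μ + 1) • B := by
    have : ((1 - A) * (1 + A)⁻¹).map (algebraMap ℝ ℂ) * N = 1 - B := by
      rw [hN, hB, ← RingHom.mapMatrix_apply, ← RingHom.mapMatrix_apply, ← RingHom.mapMatrix_apply,
        ← map_mul, Matrix.nonsing_inv_mul_cancel_right _ _ hdet, map_sub, map_one]
    rw [sub_mul, this, hN1, Algebra.algebraMap_eq_smul_one, smul_mul_assoc, one_mul]
    module
  have hnu : ¬ IsUnit ((μ - 1) • (1 : Matrix (Fin d) (Fin d) ℂ) + (μ + 1) • B) := by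
    rw [← key]
    intro h
    apply spectrum.mem_iff.1 hμ
    exact (IsUnit.mul_right_iff hNu).1 h
  by_cases h1 : μ + 1 = 0
  · exfalso; apply hnu
    have : μ - 1 = -2 := by linear_combination h1
    rw [h1, this, zero_smul, add_zero]
    exact (isUnit_one).smul (Units.mk0 (-2 : ℂ) (by norm_num))
  · have hl : (μ - 1) / (μ + 1) ∈ spectrum ℂ ((-A).map (algebraMap ℝ ℂ)) := by
      rw [spectrum.mem_iff]
      intro h
      apply hnu
      have h2 := h.smul (Units.mk0 (μ + 1) h1)
      convert h2 using 1
      have h3 : (-A).map (algebraMap ℝ ℂ) = -B := by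
        rw [hB, ← RingHom.mapMatrix_apply, map_neg]; rfl
      rw [h3, Algebra.algebraMap_eq_smul_one, Units.smul_def, Units.val_mk0, smul_sub, smul_smul,
        mul_div_cancel₀ _ h1, smul_neg, sub_neg_eq_add]
    have hre := hA _ hl
    have hpos : 0 < Complex.normSq (μ + 1) := Complex.normSq_pos.2 h1
    rw [Complex.div_re, ← add_div, div_neg_iff] at hre
    have h4 : (μ - 1).re * (μ + 1).re + (μ - 1).im * (μ + 1).im < 0 := by
      rcases hre with h | h
      · linarith [h.2]
      · exact h.1
    have h5 : ‖μ‖ ^ 2 < 1 := by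
      rw [← Complex.normSq_eq_norm_sq, Complex.normSq_apply]
      simp at h4
      nlinarith
    have := norm_nonneg μ
    nlinarith

section Decay

attribute [local instance] Matrix.frobeniusNormedRing Matrix.frobeniusNormedAlgebra

theorem cayley_decay {A : Matrix (Fin d) (Fin d) ℝ} (hA : IsHurwitz (-A)) :
    ∃ r : ℝ, 0 ≤ r ∧ r < 1 ∧ ∀ᶠ n : ℕ in atTop, ‖((1 - A) * (1 + A)⁻¹) ^ n‖ ≤ r ^ n := by
  set C := (1 - A) * (1 + A)⁻¹ with hC
  have hrad : spectralRadius ℂ (C.map (algebraMap ℝ ℂ)) < 1 := by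
    rcases isEmpty_or_nonempty (Fin d) with hd | hd
    · simp [spectralRadius]
    · have : CompleteSpace (Matrix (Fin d) (Fin d) ℂ) := FiniteDimensional.complete ℂ _
      have := spectrum.spectralRadius_lt_of_forall_lt (C.map (algebraMap ℝ ℂ)) (r := 1)
        (fun z hz => by exact_mod_cast cayley_spectrum hA z hz)
      simpa using this
  obtain ⟨r, hr0, hr1⟩ := ENNReal.lt_iff_exists_nnreal_btwn.1 hrad
  refine ⟨r, r.2, by exact_mod_cast hr1, ?_⟩
  have : CompleteSpace (Matrix (Fin d) (Fin d) ℂ) := FiniteDimensional.complete ℂ _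
  have ht := spectrum.pow_nnnorm_pow_one_div_tendsto_nhds_spectralRadius (C.map (algebraMap ℝ ℂ))
  filter_upwards [ht.eventually (gt_mem_nhds hr0), eventually_gt_atTop 0] with n hn hn0
  have h1 : ((C.map (algebraMap ℝ ℂ)) ^ n) = (C ^ n).map (algebraMap ℝ ℂ) := by
    rw [← RingHom.mapMatrix_apply, ← RingHom.mapMatrix_apply, map_pow]
  have h2 : ‖(C ^ n).map (algebraMap ℝ ℂ)‖₊ = ‖C ^ n‖₊ :=
    Matrix.frobenius_nnnorm_map_eq _ _ (by simp)
  rw [h1, h2] at hn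
  have h3 := ENNReal.rpow_le_rpow hn.le (Nat.cast_nonneg n : (0:ℝ) ≤ n)
  rw [← ENNReal.rpow_mul, one_div, inv_mul_cancel₀ (by positivity), ENNReal.rpow_one,
    ENNReal.rpow_natCast] at h3
  exact_mod_cast h3

theorem lyapunov_exists_unique (A : Matrix (Fin d) (Fin d) ℝ) (hA : IsHurwitz (-A)) :
    ∃! P : Matrix (Fin d) (Fin d) ℝ, P.PosDef ∧ Aᵀ * P + P * A = 1 := by
  obtain ⟨r, hr0, hr1, hr⟩ := cayley_decay hA
  set C := (1 - A) * (1 + A)⁻¹ with hC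
  have hu := isUnit_one_add hA
  have hdet : IsUnit (1 + A).det := (Matrix.isUnit_iff_isUnit_det _).1 hu
  have hCN : C * (1 + A) = 1 - A := Matrix.nonsing_inv_mul_cancel_right _ _ hdet
  have hCNt : (1 + A)ᵀ * Cᵀ = (1 - A)ᵀ := by rw [← Matrix.transpose_mul, hCN]
  have : CompleteSpace (Matrix (Fin d) (Fin d) ℝ) := FiniteDimensional.complete ℝ _
  have htr : ∀ n, (C ^ n)ᵀ = Cᵀ ^ n := fun n => Matrix.transpose_pow _ _
  have hbd : ∀ W : Matrix (Fin d) (Fin d) ℝ, ∀ᶠ n : ℕ in atTop,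
      ‖Cᵀ ^ n * W * C ^ n‖ ≤ ‖W‖ * (r * r) ^ n := by
    intro W
    filter_upwards [hr] with n hn
    have hn' : ‖Cᵀ ^ n‖ ≤ r ^ n := by rw [← htr, Matrix.frobenius_norm_transpose]; exact hn
    calc _ ≤ ‖Cᵀ ^ n‖ * ‖W‖ * ‖C ^ n‖ := norm_mul₃_le
      _ ≤ r ^ n * ‖W‖ * r ^ n := by gcongr
      _ = _ := by rw [mul_pow]; ring
  have hrr : r * r < 1 := by nlinarith
  refine existsUnique_of_exists_of_unique ?_ ?_
  · set W : Matrix (Fin d) (Fin d) ℝ := (2 : ℝ) • (((1 + A)⁻¹)ᵀ * (1 + A)⁻¹) with hW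
    have hWN : (1 + A)ᵀ * W * (1 + A) = (2 : ℝ) • 1 := by
      rw [hW, Matrix.mul_smul, Matrix.smul_mul, ← mul_assoc, ← Matrix.transpose_mul,
        Matrix.nonsing_inv_mul _ hdet, Matrix.transpose_one, one_mul, Matrix.nonsing_inv_mul _ hdet]
    have hWs : Wᵀ = W := by simp [hW, Matrix.transpose_smul, Matrix.transpose_mul]
    have hs : Summable fun n => Cᵀ ^ n * W * C ^ n := by
      refine Summable.of_norm_bounded_eventually_nat
        ((summable_geometric_of_lt_one (mul_nonneg hr0 hr0) hrr).mul_left ‖W‖) (hbd W)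
    set P := ∑' n, Cᵀ ^ n * W * C ^ n with hP
    have hPs : Pᵀ = P := by
      rw [hP, Matrix.transpose_tsum]
      congr 1; ext1 n
      rw [Matrix.transpose_mul, Matrix.transpose_mul, hWs, ← htr, Matrix.transpose_transpose,
        mul_assoc]
    have hrec : P = W + Cᵀ * P * C := by
      conv_lhs => rw [hP, hs.tsum_eq_zero_add]
      rw [hP, ← hs.tsum_mul_left, ← (hs.mul_left _).tsum_mul_right]
      simp [pow_succ', mul_assoc]
      congr 1; ext1 n
      simp only [← mul_assoc, ← pow_succ, ← pow_succ']
    have hquad : ∀ x : Fin d → ℝ, x ≠ 0 → 0 < x ⬝ᵥ (P *ᵥ x) := by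
      intro x hx
      let φ : Matrix (Fin d) (Fin d) ℝ →+ ℝ :=
        { toFun := fun M => x ⬝ᵥ (M *ᵥ x)
          map_zero' := by simp
          map_add' := fun M M' => by rw [Matrix.add_mulVec, dotProduct_add] }
      have hφ : Continuous φ := by
        change Continuous fun M : Matrix (Fin d) (Fin d) ℝ => x ⬝ᵥ (M *ᵥ x)
        fun_prop
      have h1 := hs.hasSum.map φ hφ
      have hterm : ∀ n, φ (Cᵀ ^ n * W * C ^ n) =
          2 * (((1 + A)⁻¹ *ᵥ (C ^ n *ᵥ x)) ⬝ᵥ ((1 + A)⁻¹ *ᵥ (C ^ n *ᵥ x))) := by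
        intro n
        change x ⬝ᵥ ((Cᵀ ^ n * W * C ^ n) *ᵥ x) = _
        rw [hW, ← htr]
        simp only [Matrix.mul_smul, Matrix.smul_mul, Matrix.smul_mulVec, dotProduct_smul,
          smul_eq_mul, ← Matrix.mulVec_mulVec, Matrix.dotProduct_mulVec, Matrix.vecMul_transpose]
      have hnn : ∀ n, 0 ≤ φ (Cᵀ ^ n * W * C ^ n) := by
        intro n; rw [hterm]
        exact mul_nonneg zero_le_two (Finset.sum_nonneg fun i _ => mul_self_nonneg _)
      have h0 : 0 < φ (Cᵀ ^ 0 * W * C ^ 0) := by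
        rw [hterm]
        have hne : (1 + A)⁻¹ *ᵥ (C ^ 0 *ᵥ x) ≠ 0 := by
          intro h
          apply hx
          have := congrArg (fun y => (1 + A) *ᵥ y) h
          simpa [Matrix.mulVec_mulVec, Matrix.mul_nonsing_inv _ hdet] using this
        refine mul_pos zero_lt_two (lt_of_le_of_ne
          (Finset.sum_nonneg fun i _ => mul_self_nonneg _) fun h => hne ?_)
        exact dotProduct_self_eq_zero.1 h.symm
      have := le_hasSum h1 0 (fun n _ => hnn n)
      exact lt_of_lt_of_le h0 this
    refine ⟨P, Matrix.PosDef.of_dotProduct_mulVec_pos ?_ ?_, ?_⟩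
    · rw [Matrix.IsHermitian, Matrix.conjTranspose_eq_transpose_of_trivial, hPs]
    · intro x hx; simpa using hquad x hx
    · have h1 : (1 + A)ᵀ * P * (1 + A) = (2 : ℝ) • 1 + (1 - A)ᵀ * P * (1 - A) := by
        calc (1 + A)ᵀ * P * (1 + A) = (1 + A)ᵀ * (W + Cᵀ * P * C) * (1 + A) := by rw [← hrec]
          _ = (1 + A)ᵀ * W * (1 + A) + ((1 + A)ᵀ * Cᵀ) * P * (C * (1 + A)) := by
              rw [mul_add (1 + A)ᵀ W, add_mul _ _ (1 + A)]; simp only [mul_assoc]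
          _ = _ := by rw [hWN, hCN, hCNt]
      have h2 : (2 : ℝ) • (Aᵀ * P + P * A) = (2 : ℝ) • 1 := by
        simp only [Matrix.transpose_add, Matrix.transpose_sub, Matrix.transpose_one] at h1
        have h3 := sub_eq_iff_eq_add.2 h1
        rw [← h3, two_smul]; noncomm_ring
      exact smul_right_injective _ (two_ne_zero' ℝ) h2
  · rintro P₁ P₂ ⟨-, h₁⟩ ⟨-, h₂⟩
    set D := P₁ - P₂ with hD
    have hDl : Aᵀ * D + D * A = 0 := by
      rw [hD, mul_sub, sub_mul, ← sub_eq_zero.2 (h₁.trans h₂.symm)]; abel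
    have h1 : (1 + A)ᵀ * D * (1 + A) = (1 - A)ᵀ * D * (1 - A) := by
      simp only [Matrix.transpose_add, Matrix.transpose_sub, Matrix.transpose_one]
      rw [← sub_eq_zero]
      have : (1 + Aᵀ) * D * (1 + A) - (1 - Aᵀ) * D * (1 - A) = (2:ℤ) • (Aᵀ * D + D * A) := by
        noncomm_ring
      rw [this, hDl, smul_zero]
    have h2 : Cᵀ * D * C = D := by
      have hut : IsUnit (1 + A)ᵀ := by
        rw [Matrix.isUnit_iff_isUnit_det, Matrix.det_transpose]; exact hdet
      apply hut.mul_left_cancel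
      apply hu.mul_right_cancel
      calc (1 + A)ᵀ * (Cᵀ * D * C) * (1 + A) = ((1 + A)ᵀ * Cᵀ) * D * (C * (1 + A)) := by
            simp only [mul_assoc]
        _ = _ := by rw [h1, hCN, hCNt]
    have h3 : ∀ n, Cᵀ ^ n * D * C ^ n = D := by
      intro n
      induction n with
      | zero => simp
      | succ n ih =>
        calc Cᵀ ^ (n + 1) * D * C ^ (n + 1) = Cᵀ ^ n * (Cᵀ * D * C) * C ^ n := by
              rw [pow_succ, pow_succ']; simp only [mul_assoc]
          _ = D := by rw [h2, ih]
    have h4 : Tendsto (fun n : ℕ => ‖D‖ * (r * r) ^ n) atTop (𝓝 (‖D‖ * 0)) :=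
      (tendsto_pow_atTop_nhds_zero_of_lt_one (mul_nonneg hr0 hr0) hrr).const_mul _
    have h5 : ‖D‖ ≤ 0 := by
      rw [mul_zero] at h4
      refine ge_of_tendsto h4 ?_
      filter_upwards [hbd D] with n hn
      rwa [h3] at hn
    exact sub_eq_zero.1 (norm_le_zero_iff.1 h5)

end Decay

end Lyapunov

open Classical in
/-- The symmetric positive definite solution `P` of the Lyapunov equation `Aᵀ P + P A = I`.
When `-A` is Hurwitz it exists and is unique (`lyapunov_exists_unique`). -/
noncomputable def lyapunovMatrix {d : ℕ} (A : Matrix (Fin d) (Fin d) ℝ) :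
    Matrix (Fin d) (Fin d) ℝ :=
  if h : ∃ P : Matrix (Fin d) (Fin d) ℝ, P.PosDef ∧ Aᵀ * P + P * A = 1 then h.choose else 0

theorem lyapunovMatrix_spec {d : ℕ} (A : Matrix (Fin d) (Fin d) ℝ) (hA : IsHurwitz (-A)) :
    (lyapunovMatrix A).PosDef ∧ Aᵀ * lyapunovMatrix A + lyapunovMatrix A * A = 1 := by
  have h := (lyapunov_exists_unique A hA).exists
  rw [lyapunovMatrix, dif_pos h]
  exact h.choose_spec

/-- The action of a matrix on Euclidean space, as a continuous linear map. -/
noncomputable def act {d : ℕ} (M : Matrix (Fin d) (Fin d) ℝ) :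
    EuclideanSpace ℝ (Fin d) →L[ℝ] EuclideanSpace ℝ (Fin d) :=
  Matrix.toEuclideanCLM (n := Fin d) (𝕜 := ℝ) M

/-- The spectral norm of a matrix. -/
noncomputable def opNorm {d : ℕ} (M : Matrix (Fin d) (Fin d) ℝ) : ℝ := ‖act M‖

/-- The weighted vector norm `(xᵀ P x)^{1/2}`. -/
noncomputable def vecNormQ {d : ℕ} (P : Matrix (Fin d) (Fin d) ℝ) (x : Fin d → ℝ) : ℝ :=
  √(x ⬝ᵥ (P *ᵥ x))

/-- The operator norm of `M` associated with `vecNormQ P`. -/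
noncomputable def opNormQ {d : ℕ} (P M : Matrix (Fin d) (Fin d) ℝ) : ℝ :=
  sSup {r : ℝ | ∃ x : Fin d → ℝ, vecNormQ P x = 1 ∧ r = vecNormQ P (M *ᵥ x)}

/-- The ratio of the largest to the smallest eigenvalue of a symmetric matrix. -/
noncomputable def condNumber {d : ℕ} (P : Matrix (Fin d) (Fin d) ℝ) : ℝ :=
  sSup (spectrum ℝ P) / sInf (spectrum ℝ P)

/-- `a = ‖Q‖⁻¹ / 2`, with `Q` the Lyapunov matrix of `Abar`. -/
noncomputable def aConst {d : ℕ} (Abar : Matrix (Fin d) (Fin d) ℝ) : ℝ :=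
  (opNorm (lyapunovMatrix Abar))⁻¹ / 2

/-- `κ_Q = λ_max(Q) / λ_min(Q)`. -/
noncomputable def kappaQ {d : ℕ} (Abar : Matrix (Fin d) (Fin d) ℝ) : ℝ :=
  condNumber (lyapunovMatrix Abar)

/-- `α_∞ = (1/2) ‖Abar‖_Q⁻² ‖Q‖⁻¹ ∧ ‖Q‖`. -/
noncomputable def alphaInf {d : ℕ} (Abar : Matrix (Fin d) (Fin d) ℝ) : ℝ :=
  min (1 / 2 * ((opNormQ (lyapunovMatrix Abar) Abar) ^ 2)⁻¹ * (opNorm (lyapunovMatrix Abar))⁻¹)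
    (opNorm (lyapunovMatrix Abar))

/-- `C_A = sup_z ‖A(z)‖ ∨ sup_z ‖A(z) - Abar‖`, for bounded `A`. -/
noncomputable def boundA {Z : Type*} {d : ℕ} (A : Z → Matrix (Fin d) (Fin d) ℝ)
    (Abar : Matrix (Fin d) (Fin d) ℝ) : ℝ :=
  max (⨆ z, opNorm (A z)) (⨆ z, opNorm (A z - Abar))

/-- `⌈8 κ_Q^{1/2} C / a⌉`. -/
noncomputable def blockCount {d : ℕ} (Abar : Matrix (Fin d) (Fin d) ℝ) (C : ℝ) : ℕ :=
  ⌈8 * √(kappaQ Abar) * C / aConst Abar⌉₊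

/-- `α_∞^{(M)}`, where `C` stands for `C_A`. -/
noncomputable def alphaInfM {d : ℕ} (Abar : Matrix (Fin d) (Fin d) ℝ) (C : ℝ) : ℝ :=
  min (alphaInf Abar)
      (min ((√(kappaQ Abar))⁻¹ * C⁻¹) (aConst Abar / (6 * Real.exp 1 * kappaQ Abar * C)))
    * (blockCount Abar C : ℝ)⁻¹

/-- `C_Γ = 4 (κ_Q^{1/2} C + a/6)² ⌈8 κ_Q^{1/2} C / a⌉`. -/
noncomputable def constGamma {d : ℕ} (Abar : Matrix (Fin d) (Fin d) ℝ) (C : ℝ) : ℝ :=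
  4 * (√(kappaQ Abar) * C + aConst Abar / 6) ^ 2 * (blockCount Abar C : ℝ)

/-- `α_{q,∞}^{(M)} = α_∞^{(M)} ∧ (a / (12 C_Γ)) / q`. -/
noncomputable def alphaQInfM {d : ℕ} (Abar : Matrix (Fin d) (Fin d) ℝ) (C q : ℝ) : ℝ :=
  min (alphaInfM Abar C) (aConst Abar / (12 * constGamma Abar C) / q)

/-- The noise `ε(z) = (A(z) - Abar) θ* - (b(z) - bbar)`. -/
noncomputable def noise {Z : Type*} {d : ℕ} (A : Z → Matrix (Fin d) (Fin d) ℝ)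
    (b : Z → EuclideanSpace ℝ (Fin d)) (Abar : Matrix (Fin d) (Fin d) ℝ)
    (bbar θstar : EuclideanSpace ℝ (Fin d)) (z : Z) : EuclideanSpace ℝ (Fin d) :=
  act (A z - Abar) θstar - (b z - bbar)

/-- One step of the recursion: `F_z(θ) = (I - α A(z)) θ + α b(z)`. -/
noncomputable def lsaStep {Z : Type*} {d : ℕ} (A : Z → Matrix (Fin d) (Fin d) ℝ)
    (b : Z → EuclideanSpace ℝ (Fin d)) (α : ℝ) (z : Z) (θ : EuclideanSpace ℝ (Fin d)) :
    EuclideanSpace ℝ (Fin d) :=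
  act (1 - α • A z) θ + α • b z

/-- Powers of a Markov kernel are Markov kernels. -/
instance isMarkovKernel_pow {Z : Type*} [MeasurableSpace Z] (Q : Kernel Z Z) [IsMarkovKernel Q]
    (k : ℕ) : IsMarkovKernel (Q ^ k) := by
  induction k with
  | zero => rw [pow_zero]; change IsMarkovKernel (Kernel.id : Kernel Z Z); infer_instance
  | succ k ih => rw [pow_succ]; change IsMarkovKernel ((Q ^ k) ∘ₖ Q); infer_instance

/-- The Dobrushin coefficient `sup_{z,z'} (1/2) ‖κ(z,·) - κ(z',·)‖_TV`, where `‖μ‖_TV = |μ|(Z)`. -/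
noncomputable def dobrushin {Z : Type*} [MeasurableSpace Z] (κ : Kernel Z Z) [IsFiniteKernel κ] :
    ℝ≥0∞ :=
  ⨆ (z : Z) (z' : Z),
    (1 / 2) * ((κ z).toSignedMeasure - (κ z').toSignedMeasure).totalVariation Set.univ

/-- The kernel of the joint chain `(θ_k, Z_{k+1})`: from `(θ, z)` draw `z'` from `Q(z, ·)` and
move to `(F_{z'}(θ), z')`. See `jointKernel_apply` and `lintegral_jointKernel`. -/
noncomputable def jointKernel {Z : Type*} [MeasurableSpace Z] {d : ℕ} (Q : Kernel Z Z)
    (A : Z → Matrix (Fin d) (Fin d) ℝ) (b : Z → EuclideanSpace ℝ (Fin d)) (α : ℝ) :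
    Kernel (EuclideanSpace ℝ (Fin d) × Z) (EuclideanSpace ℝ (Fin d) × Z) :=
  Kernel.map (Kernel.id ×ₖ Q.comap Prod.snd measurable_snd)
    (fun p : (EuclideanSpace ℝ (Fin d) × Z) × Z => (lsaStep A b α p.2 p.1.1, p.2))

theorem measurable_lsaStep {Z : Type*} [MeasurableSpace Z] {d : ℕ}
    (A : Z → Matrix (Fin d) (Fin d) ℝ) (b : Z → EuclideanSpace ℝ (Fin d)) (α : ℝ)
    (hA : ∀ i j, Measurable fun z => A z i j) (hb : Measurable b) :
    Measurable fun p : Z × EuclideanSpace ℝ (Fin d) => lsaStep A b α p.1 p.2 := by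
  have h : Measurable fun p : Z × EuclideanSpace ℝ (Fin d) => act (1 - α • A p.1) p.2 := by
    have h' : Measurable fun p : Z × EuclideanSpace ℝ (Fin d) =>
        ((1 - α • A p.1) *ᵥ (WithLp.ofLp p.2) : Fin d → ℝ) := by
      refine measurable_pi_lambda _ fun i => ?_
      simp only [Matrix.mulVec, dotProduct]
      refine Finset.measurable_sum _ fun j _ => Measurable.mul ?_ ?_
      · simp only [Matrix.sub_apply, Matrix.smul_apply, smul_eq_mul]
        exact measurable_const.sub (((hA i j).comp measurable_fst).const_mul α)
      · fun_prop
    exact (WithLp.measurable_toLp 2 _).comp h'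
  unfold lsaStep
  exact h.add ((hb.comp measurable_fst).const_smul α)

theorem jointKernel_apply {Z : Type*} [MeasurableSpace Z] {d : ℕ} (Q : Kernel Z Z)
    [IsMarkovKernel Q] (A : Z → Matrix (Fin d) (Fin d) ℝ) (b : Z → EuclideanSpace ℝ (Fin d)) (α : ℝ)
    (hA : ∀ i j, Measurable fun z => A z i j) (hb : Measurable b)
    (y : EuclideanSpace ℝ (Fin d) × Z) :
    jointKernel Q A b α y = (Q y.2).map fun z' => (lsaStep A b α z' y.1, z') := by
  have hm := measurable_lsaStep A b α hA hb
  have hm' : Measurable fun p : (EuclideanSpace ℝ (Fin d) × Z) × Z =>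
      (lsaStep A b α p.2 p.1.1, p.2) :=
    (hm.comp (measurable_snd.prodMk measurable_fst.fst)).prodMk measurable_snd
  rw [jointKernel, Kernel.map_apply _ hm', Kernel.prod_apply, Kernel.id_apply, Kernel.comap_apply,
    Measure.dirac_prod, Measure.map_map hm' measurable_prodMk_left]
  rfl

/-- `P_α f(θ, z) = ∫ Q(z, dz') f(F_{z'}(θ), z')`. -/
theorem lintegral_jointKernel {Z : Type*} [MeasurableSpace Z] {d : ℕ} (Q : Kernel Z Z)
    [IsMarkovKernel Q] (A : Z → Matrix (Fin d) (Fin d) ℝ) (b : Z → EuclideanSpace ℝ (Fin d)) (α : ℝ)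
    (hA : ∀ i j, Measurable fun z => A z i j) (hb : Measurable b)
    (f : EuclideanSpace ℝ (Fin d) × Z → ℝ≥0∞) (hf : Measurable f)
    (θ : EuclideanSpace ℝ (Fin d)) (z : Z) :
    ∫⁻ y, f y ∂(jointKernel Q A b α (θ, z)) = ∫⁻ z', f (lsaStep A b α z' θ, z') ∂(Q z) := by
  have hm := measurable_lsaStep A b α hA hb
  rw [jointKernel_apply Q A b α hA hb, lintegral_map hf]
  exact (hm.comp (measurable_id.prodMk measurable_const)).prodMk measurable_id

end LSA

namespace LSA

/-! Two copies of the recursion driven by the same noise differ by the homogeneous recursion `Y ↦ (I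
- α A(z)) Y`, so everything rests on a contraction estimate for products of these random matrices,
uniform in the starting noise state.

The estimate is proved in the norm of the Lyapunov matrix, written `‖R x‖` with `R` a square root of
that matrix. There the averaged drift satisfies `⟨R y, R Abar y⟩ ≥ a ‖R y‖²`. Over a block of `h = N
* t` steps, expand the square and freeze `Y` at its initial value `y` in the linear term; the error
is of order `(α K h)²`, with `K = √κ_Q C_A` (`lintegral_norm_sq_pow_le`). Mixing replaces the law of
the noise by `π` in the linear term, at a total cost proportional to `t` and independent of `N`.
Hence for `N` large and `α h` small the second moment drops by the factor `1 - h α a`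
(`lintegral_norm_sq_block_le`). Geometric decay over blocks gives `∑ₙ E‖Yₙ‖ ≤ C ‖y‖`
(`exists_tsum_lintegral_enorm_le`).

Existence: extend the stationary noise to the infinite past (`exists_stationary_past`) and start the
recursion at `θ⋆` further and further back. The increments of these backward iterates evolve in law
by the homogeneous kernel from a bounded initial value, so their norms are summable in expectation.
The limit `Θ` solves the recursion along the stationary noise; the law of `(Θ, z₀)` is invariant and
has a finite first moment around `θ⋆` (`exists_invariant_of_past`).

Uniqueness: the noise marginal of an invariant law is invariant for `Q`, hence equals `π`. For
bounded `f` Lipschitz in `θ`, the contraction makes `P_α^n f(θ, z)` asymptotically independent of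
`θ`, so `∫ f dΠ` is determined by `π` (`invariant_jointKernel_unique`). -/

theorem abs_integral_le_of_abs_le {Z : Type*} [MeasurableSpace Z] (ρ : Measure Z)
    [IsFiniteMeasure ρ] {g : Z → ℝ} {M : ℝ} (hgM : ∀ z, |g z| ≤ M) :
    |∫ z, g z ∂ρ| ≤ M * (ρ Set.univ).toReal :=
  norm_integral_le_of_norm_le_const (μ := ρ) (f := g) (ae_of_all _ hgM)

/-- The Jordan parts `j` of `μ - ν` give an identity of positive measures, `μ + j⁻ = ν + j⁺`;
integrating `g` against it reduces the difference to the two parts. -/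
theorem abs_integral_sub_integral_le_totalVariation {Z : Type*} [MeasurableSpace Z]
    (μ ν : Measure Z) [IsFiniteMeasure μ] [IsFiniteMeasure ν] {g : Z → ℝ} (hg : Measurable g)
    {M : ℝ} (hgM : ∀ z, |g z| ≤ M) :
    |∫ z, g z ∂μ - ∫ z, g z ∂ν| ≤
      M * ((μ.toSignedMeasure - ν.toSignedMeasure).totalVariation Set.univ).toReal := by
  set s := μ.toSignedMeasure - ν.toSignedMeasure with hs
  set j := s.toJordanDecomposition with hj
  have h1 : μ.toSignedMeasure - ν.toSignedMeasure =
      j.posPart.toSignedMeasure - j.negPart.toSignedMeasure := by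
    rw [← hs, ← s.toSignedMeasure_toJordanDecomposition]; rfl
  have h2 : μ + j.negPart = ν + j.posPart := by
    rw [← Measure.toSignedMeasure_eq_toSignedMeasure_iff, Measure.toSignedMeasure_add,
      Measure.toSignedMeasure_add]
    rw [sub_eq_sub_iff_add_eq_add] at h1
    rw [h1, add_comm]
  have hint : ∀ (ρ : Measure Z) [IsFiniteMeasure ρ], Integrable g ρ := fun ρ _ =>
    Integrable.of_bound hg.aestronglyMeasurable M (ae_of_all _ hgM)
  have h3 : ∫ z, g z ∂μ + ∫ z, g z ∂j.negPart = ∫ z, g z ∂ν + ∫ z, g z ∂j.posPart := by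
    rw [← integral_add_measure (hint _) (hint _), h2, integral_add_measure (hint _) (hint _)]
  have hb : ∀ (ρ : Measure Z) [IsFiniteMeasure ρ], |∫ z, g z ∂ρ| ≤ M * (ρ Set.univ).toReal :=
    fun ρ _ => abs_integral_le_of_abs_le ρ hgM
  have h4 : (s.totalVariation Set.univ).toReal =
      (j.posPart Set.univ).toReal + (j.negPart Set.univ).toReal := by
    rw [SignedMeasure.totalVariation, Measure.add_apply,
      ENNReal.toReal_add (measure_ne_top _ _) (measure_ne_top _ _)]
  rw [h4, mul_add]
  have h5 : ∫ z, g z ∂μ - ∫ z, g z ∂ν = ∫ z, g z ∂j.posPart - ∫ z, g z ∂j.negPart := by linarith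
  rw [h5]
  exact (abs_sub _ _).trans (add_le_add (hb _) (hb _))

/-! ### Consequences of uniform mixing of the noise chain -/

section Mixing

variable {Z : Type*} [MeasurableSpace Z] {Q : Kernel Z Z} [IsMarkovKernel Q]
  {π : Measure Z} [IsProbabilityMeasure π] {t : ℕ}

theorem invariant_pow {α : Type*} [MeasurableSpace α] {κ : Kernel α α} {μ : Measure α}
    (h : Kernel.Invariant κ μ) (n : ℕ) : Kernel.Invariant (κ ^ n) μ := by
  induction n with
  | zero => rw [pow_zero]; exact Measure.bind_dirac
  | succ n ih => rw [pow_succ]; exact ih.comp h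

theorem integral_eq_of_invariant {α : Type*} [MeasurableSpace α] {κ : Kernel α α}
    [IsMarkovKernel κ] {μ : Measure α} [IsProbabilityMeasure μ] (h : Kernel.Invariant κ μ)
    {f : α → ℝ} (hf : Integrable f μ) : ∫ x, f x ∂μ = ∫ x, ∫ y, f y ∂κ x ∂μ := by
  have h1 : (κ ∘ₖ Kernel.const Unit μ) () = μ := by
    rw [Kernel.comp_apply, Kernel.const_apply, h.def]
  have h2 := Kernel.integral_comp (κ := Kernel.const Unit μ) (η := κ) (a := ()) (f := f)
    (by rwa [h1])
  rwa [h1, Kernel.const_apply] at h2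

/-- The factor 2 undoes the `1/2` in the Dobrushin coefficient; `k / t` is the integer quotient,
i.e. the floor. -/
theorem abs_integral_pow_sub_integral_pow_le
    (hmix : ∀ k : ℕ, 1 ≤ k → dobrushin (Q ^ k) ≤ (1 / 4 : ℝ≥0∞) ^ (k / t))
    {g : Z → ℝ} (hg : Measurable g) {M : ℝ} (hM : 0 ≤ M) (hgM : ∀ z, |g z| ≤ M)
    {k : ℕ} (hk : 1 ≤ k) (z z' : Z) :
    |∫ x, g x ∂(Q ^ k) z - ∫ x, g x ∂(Q ^ k) z'| ≤ 2 * M * (1 / 4 : ℝ) ^ (k / t) := by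
  refine (abs_integral_sub_integral_le_totalVariation _ _ hg hgM).trans ?_
  have h1 : (1 / 2) * (((Q ^ k) z).toSignedMeasure -
      ((Q ^ k) z').toSignedMeasure).totalVariation Set.univ ≤ (1 / 4 : ℝ≥0∞) ^ (k / t) :=
    le_trans (le_iSup₂ (f := fun z z' => (1 / 2 : ℝ≥0∞) * (((Q ^ k) z).toSignedMeasure -
      ((Q ^ k) z').toSignedMeasure).totalVariation Set.univ) z z') (hmix k hk)
  have h2 := ENNReal.toReal_mono (by finiteness) h1
  rw [ENNReal.toReal_mul, ENNReal.toReal_pow] at h2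
  norm_num at h2 ⊢
  nlinarith

/-- Average the two-point bound over `z'` with law `π`, which `Q ^ k` preserves. -/
theorem abs_integral_pow_sub_integral_le (hπ : Kernel.Invariant Q π)
    (hmix : ∀ k : ℕ, 1 ≤ k → dobrushin (Q ^ k) ≤ (1 / 4 : ℝ≥0∞) ^ (k / t))
    {g : Z → ℝ} (hg : Measurable g) {M : ℝ} (hM : 0 ≤ M) (hgM : ∀ z, |g z| ≤ M)
    {k : ℕ} (hk : 1 ≤ k) (z : Z) :
    |∫ x, g x ∂(Q ^ k) z - ∫ x, g x ∂π| ≤ 2 * M * (1 / 4 : ℝ) ^ (k / t) := by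
  have hint : ∀ (ρ : Measure Z) [IsFiniteMeasure ρ], Integrable g ρ := fun ρ _ =>
    Integrable.of_bound hg.aestronglyMeasurable M (ae_of_all _ hgM)
  have h1 : ∫ x, g x ∂π = ∫ z', ∫ x, g x ∂(Q ^ k) z' ∂π :=
    integral_eq_of_invariant (invariant_pow hπ k) (hint _)
  have h2 : Integrable (fun z' => ∫ x, g x ∂(Q ^ k) z') π := by
    refine Integrable.of_bound (hg.stronglyMeasurable.integral_kernel).aestronglyMeasurable M
      (ae_of_all _ fun z' => ?_)
    simpa using abs_integral_le_of_abs_le ((Q ^ k) z') hgM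
  have h3 : ∫ x, g x ∂(Q ^ k) z - ∫ x, g x ∂π =
      ∫ z', (∫ x, g x ∂(Q ^ k) z - ∫ x, g x ∂(Q ^ k) z') ∂π := by
    rw [integral_sub (integrable_const _) h2, ← h1]; simp
  rw [h3]
  simpa using abs_integral_le_of_abs_le π
    (fun z' => abs_integral_pow_sub_integral_pow_le hmix hg hM hgM hk z z')

theorem tendsto_quarter_pow_div (ht : 1 ≤ t) :
    Tendsto (fun k : ℕ => (1 / 4 : ℝ) ^ (k / t)) atTop (𝓝 0) :=
  (tendsto_pow_atTop_nhds_zero_of_lt_one (by norm_num) (by norm_num)).comp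
    (Nat.tendsto_div_const_atTop (by omega))

theorem invariant_unique (hπ : Kernel.Invariant Q π) (ht : 1 ≤ t)
    (hmix : ∀ k : ℕ, 1 ≤ k → dobrushin (Q ^ k) ≤ (1 / 4 : ℝ≥0∞) ^ (k / t))
    {ν : Measure Z} [IsProbabilityMeasure ν] (hν : Kernel.Invariant Q ν) : ν = π := by
  ext B hB
  have hg : Measurable (B.indicator (1 : Z → ℝ)) := measurable_one.indicator hB
  have hg1 : ∀ z, |B.indicator (1 : Z → ℝ) z| ≤ 1 := fun z => by
    by_cases h : z ∈ B <;> simp [h]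
  have h1 : ∀ k : ℕ, 1 ≤ k → |ν.real B - π.real B| ≤ 2 * (1 / 4 : ℝ) ^ (k / t) := by
    intro k hk
    have hint : Integrable (B.indicator (1 : Z → ℝ)) ν :=
      Integrable.of_bound hg.aestronglyMeasurable 1 (ae_of_all _ hg1)
    have h2 : Integrable (fun z' => ∫ x, B.indicator (1 : Z → ℝ) x ∂(Q ^ k) z') ν := by
      refine Integrable.of_bound (hg.stronglyMeasurable.integral_kernel).aestronglyMeasurable 1
        (ae_of_all _ fun z' => ?_)
      simpa using abs_integral_le_of_abs_le ((Q ^ k) z') hg1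
    have h3 : ∫ x, B.indicator (1 : Z → ℝ) x ∂ν =
        ∫ z', ∫ x, B.indicator (1 : Z → ℝ) x ∂(Q ^ k) z' ∂ν :=
      integral_eq_of_invariant (invariant_pow hν k) hint
    rw [← integral_indicator_one hB, ← integral_indicator_one hB, h3]
    have h4 : ∫ z', ∫ x, B.indicator (1 : Z → ℝ) x ∂(Q ^ k) z' ∂ν -
        ∫ x, B.indicator (1 : Z → ℝ) x ∂π = ∫ z', (∫ x, B.indicator (1 : Z → ℝ) x ∂(Q ^ k) z' -
        ∫ x, B.indicator (1 : Z → ℝ) x ∂π) ∂ν := by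
      rw [integral_sub h2 (integrable_const _)]; simp
    rw [h4]
    have := abs_integral_le_of_abs_le ν (fun z' =>
      abs_integral_pow_sub_integral_le hπ hmix hg zero_le_one hg1 hk z')
    simpa using this
  have h2 : |ν.real B - π.real B| ≤ 0 := by
    have := (tendsto_quarter_pow_div ht).const_mul 2
    rw [mul_zero] at this
    exact ge_of_tendsto this (eventually_atTop.2 ⟨1, h1⟩)
  have h3 : ν.real B = π.real B := sub_eq_zero.1 (abs_nonpos_iff.1 h2)
  exact (measureReal_eq_measureReal_iff).1 h3

/-- The exponent `l / t` is constant on runs of length `t`, so the sum is `t` times a geometric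
series; shifting `l` to `l + 1` only lowers the terms. The bound does not depend on `N`, which is
what lets a long block absorb the mixing error. -/
theorem sum_quarter_pow_div_le (ht : 1 ≤ t) (N : ℕ) :
    ∑ l ∈ Finset.range (N * t), (1 / 4 : ℝ) ^ ((l + 1) / t) ≤ 4 / 3 * t := by
  have h1 : ∀ N : ℕ, ∑ l ∈ Finset.range (N * t), (1 / 4 : ℝ) ^ (l / t) =
      4 / 3 * t * (1 - (1 / 4 : ℝ) ^ N) := by
    intro N
    induction N with
    | zero => simp
    | succ N ih =>
      rw [add_mul, one_mul, Finset.sum_range_add, ih]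
      have : ∀ i ∈ Finset.range t, (1 / 4 : ℝ) ^ ((N * t + i) / t) = (1 / 4 : ℝ) ^ N := by
        intro i hi
        congr 1
        rw [mul_comm, Nat.mul_add_div (by omega), Nat.div_eq_of_lt (Finset.mem_range.1 hi),
          add_zero]
      rw [Finset.sum_congr rfl this, Finset.sum_const, Finset.card_range, nsmul_eq_mul, pow_succ]
      ring
  calc _ ≤ ∑ l ∈ Finset.range (N * t), (1 / 4 : ℝ) ^ (l / t) := by
        refine Finset.sum_le_sum fun l _ => ?_
        exact pow_le_pow_of_le_one (by norm_num) (by norm_num) (Nat.div_le_div_right (by omega))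
    _ = _ := h1 N
    _ ≤ _ := by
      have : 0 ≤ 4 / 3 * (t : ℝ) * (1 / 4 : ℝ) ^ N := by positivity
      linarith

end Mixing

/-! ### The norm of the Lyapunov matrix -/

section Weighted

variable {d : ℕ}

theorem act_mul_apply (M N : Matrix (Fin d) (Fin d) ℝ) (x : EuclideanSpace ℝ (Fin d)) :
    act (M * N) x = act M (act N x) := by
  simp [act]

theorem inner_act_transpose (M : Matrix (Fin d) (Fin d) ℝ) (x y : EuclideanSpace ℝ (Fin d)) :
    inner ℝ x (act Mᵀ y) = inner ℝ (act M x) y := by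
  rw [act, act, Matrix.inner_toEuclideanCLM, real_inner_comm, EuclideanSpace.inner_eq_star_dotProduct]
  simp [Matrix.dotProduct_mulVec, Matrix.vecMul_transpose]

theorem norm_act_le (M : Matrix (Fin d) (Fin d) ℝ) (x : EuclideanSpace ℝ (Fin d)) :
    ‖act M x‖ ≤ opNorm M * ‖x‖ :=
  (act M).le_opNorm x

variable {P : Matrix (Fin d) (Fin d) ℝ}

theorem sInf_spectrum_pos [NeZero d] (hP : P.PosDef) : 0 < sInf (spectrum ℝ P) := by
  have h := hP.1.spectrum_real_eq_range_eigenvalues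
  have hfin : (spectrum ℝ P).Finite := Matrix.finite_real_spectrum
  have hne : (spectrum ℝ P).Nonempty := by rw [h]; exact Set.range_nonempty _
  have := hne.csInf_mem hfin
  rw [h] at this ⊢
  obtain ⟨i, hi⟩ := this
  rw [← hi]
  exact hP.eigenvalues_pos i

theorem posSemidef_of_spectrum_nonneg (hP : P.IsHermitian) (h : ∀ r ∈ spectrum ℝ P, 0 ≤ r) :
    P.PosSemidef :=
  hP.posSemidef_iff_eigenvalues_nonneg.2 fun i => h _ (hP.eigenvalues_mem_spectrum_real i)

theorem sInf_spectrum_mul_le (hP : P.IsHermitian) (x : EuclideanSpace ℝ (Fin d)) :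
    sInf (spectrum ℝ P) * ‖x‖ ^ 2 ≤ inner ℝ x (act P x) := by
  have hfin : (spectrum ℝ P).Finite := Matrix.finite_real_spectrum
  set m := sInf (spectrum ℝ P)
  have hps : (P - m • 1).PosSemidef := by
    refine posSemidef_of_spectrum_nonneg (hP.sub ?_) fun r hr => ?_
    · simp [Matrix.IsHermitian]
    · have : m + r ∈ spectrum ℝ P := by
        have h := (spectrum.add_mem_add_iff (r := r) (s := m) (a := P - m • 1)).2 hr
        rw [Algebra.algebraMap_eq_smul_one] at h
        simpa [add_comm] using h
      linarith [csInf_le hfin.bddBelow this]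
  have h := hps.dotProduct_mulVec_nonneg x.ofLp
  rw [act, Matrix.inner_toEuclideanCLM, EuclideanSpace.real_norm_sq_eq]
  simp [Matrix.sub_mulVec, Matrix.smul_mulVec, dotProduct, mul_sub, Finset.sum_sub_distrib] at h
  rw [Finset.mul_sum]
  simpa [dotProduct, sq, mul_left_comm] using h

theorem le_sSup_spectrum_mul (hP : P.IsHermitian) (x : EuclideanSpace ℝ (Fin d)) :
    inner ℝ x (act P x) ≤ sSup (spectrum ℝ P) * ‖x‖ ^ 2 := by
  have h := sInf_spectrum_mul_le hP.neg x
  rw [← spectrum.neg_eq, Real.sInf_neg] at h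
  have : act (-P) x = - act P x := by simp [act]
  rw [this, inner_neg_right] at h
  linarith

-- Through the square root `R` of `P`, the weighted norm becomes `‖R x‖`, so the inner product
-- calculus of Euclidean space applies to it directly.
open scoped MatrixOrder in
theorem exists_factor (hP : P.PosSemidef) :
    ∃ R : EuclideanSpace ℝ (Fin d) →L[ℝ] EuclideanSpace ℝ (Fin d),
      ∀ x y, inner ℝ (R x) (R y) = inner ℝ x (act P y) := by
  have h : (CFC.sqrt P)ᵀ = CFC.sqrt P := by
    rw [← Matrix.conjTranspose_eq_transpose_of_trivial]
    exact (CFC.sqrt_nonneg P).isSelfAdjoint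
  refine ⟨act (CFC.sqrt P), fun x y => ?_⟩
  rw [← inner_act_transpose, h, ← act_mul_apply, CFC.sqrt_mul_sqrt_self P hP.nonneg]

/-- Passing to the weighted norm and back costs `λ_max` and `1/λ_min` on squares, hence the root of
the condition number. -/
theorem norm_factor_act_le [NeZero d] (hP : P.PosDef)
    {R : EuclideanSpace ℝ (Fin d) →L[ℝ] EuclideanSpace ℝ (Fin d)}
    (hR : ∀ x y, inner ℝ (R x) (R y) = inner ℝ x (act P y)) (M : Matrix (Fin d) (Fin d) ℝ)
    (x : EuclideanSpace ℝ (Fin d)) :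
    ‖R (act M x)‖ ≤ √(condNumber P) * opNorm M * ‖R x‖ := by
  have hm := sInf_spectrum_pos hP
  have h1 := le_sSup_spectrum_mul hP.1 (act M x)
  have h2 := sInf_spectrum_mul_le hP.1 x
  have hM : sInf (spectrum ℝ P) ≤ sSup (spectrum ℝ P) :=
    Real.sInf_le_sSup _ Matrix.finite_real_spectrum.bddBelow Matrix.finite_real_spectrum.bddAbove
  rw [← hR, real_inner_self_eq_norm_sq] at h1 h2
  have hκ : 0 ≤ condNumber P := div_nonneg (hm.le.trans hM) hm.le
  have h0 : 0 ≤ opNorm M := norm_nonneg _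
  refine abs_le_of_sq_le_sq' ?_ (by positivity) |>.2
  rw [mul_pow, mul_pow, Real.sq_sqrt hκ]
  have h3 : ‖x‖ ^ 2 ≤ (sInf (spectrum ℝ P))⁻¹ * ‖R x‖ ^ 2 := by
    rw [inv_mul_eq_div, le_div_iff₀ hm]; linarith
  have h4 : ‖act M x‖ ^ 2 ≤ opNorm M ^ 2 * ‖x‖ ^ 2 := by
    rw [← mul_pow]; exact pow_le_pow_left₀ (norm_nonneg _) (norm_act_le M x) 2
  calc ‖R (act M x)‖ ^ 2 ≤ sSup (spectrum ℝ P) * ‖act M x‖ ^ 2 := h1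
    _ ≤ sSup (spectrum ℝ P) * (opNorm M ^ 2 * ((sInf (spectrum ℝ P))⁻¹ * ‖R x‖ ^ 2)) := by
        have := hm.le.trans hM
        gcongr
        exact h4.trans (by gcongr)
    _ = _ := by rw [condNumber]; ring

theorem norm_le_mul_norm_factor [NeZero d] (hP : P.PosDef)
    {R : EuclideanSpace ℝ (Fin d) →L[ℝ] EuclideanSpace ℝ (Fin d)}
    (hR : ∀ x y, inner ℝ (R x) (R y) = inner ℝ x (act P y)) (x : EuclideanSpace ℝ (Fin d)) :
    ‖x‖ ≤ √(sInf (spectrum ℝ P))⁻¹ * ‖R x‖ := by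
  have hm := sInf_spectrum_pos hP
  have h2 := sInf_spectrum_mul_le hP.1 x
  rw [← hR, real_inner_self_eq_norm_sq] at h2
  refine abs_le_of_sq_le_sq' ?_ (by positivity) |>.2
  rw [mul_pow, Real.sq_sqrt (by positivity), inv_mul_eq_div, le_div_iff₀ hm]
  linarith

theorem inner_factor_act_eq {A : Matrix (Fin d) (Fin d) ℝ}
    (hA : Aᵀ * P + P * A = 1)
    {R : EuclideanSpace ℝ (Fin d) →L[ℝ] EuclideanSpace ℝ (Fin d)}
    (hR : ∀ x y, inner ℝ (R x) (R y) = inner ℝ x (act P y)) (x : EuclideanSpace ℝ (Fin d)) :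
    inner ℝ (R x) (R (act A x)) = ‖x‖ ^ 2 / 2 := by
  have h : inner ℝ x (act (Aᵀ * P + P * A) x) = ‖x‖ ^ 2 := by
    rw [hA, ← real_inner_self_eq_norm_sq]; simp [act]
  have h1 : act (Aᵀ * P + P * A) x = act (Aᵀ * P) x + act (P * A) x := by simp [act]
  rw [h1, inner_add_right, act_mul_apply, act_mul_apply, inner_act_transpose, ← hR, ← hR,
    real_inner_comm] at h
  linarith

/-- The Lyapunov equation makes the right side exactly `‖x‖² / 2`, and `‖R x‖² ≤ ‖P‖ ‖x‖²`; this is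
where the rate `a` comes from. -/
theorem mul_norm_factor_sq_le {A : Matrix (Fin d) (Fin d) ℝ}
    (hA : Aᵀ * P + P * A = 1)
    {R : EuclideanSpace ℝ (Fin d) →L[ℝ] EuclideanSpace ℝ (Fin d)}
    (hR : ∀ x y, inner ℝ (R x) (R y) = inner ℝ x (act P y)) (x : EuclideanSpace ℝ (Fin d)) :
    (opNorm P)⁻¹ / 2 * ‖R x‖ ^ 2 ≤ inner ℝ (R x) (R (act A x)) := by
  rw [inner_factor_act_eq hA hR, ← real_inner_self_eq_norm_sq (R x), hR]
  have h0 : 0 ≤ opNorm P := norm_nonneg _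
  have h1 : inner ℝ x (act P x) ≤ opNorm P * ‖x‖ ^ 2 := by
    refine (real_inner_le_norm _ _).trans ?_
    nlinarith [norm_act_le P x, norm_nonneg x]
  rcases h0.eq_or_lt with h | h
  · rw [← h]; simp; positivity
  · have : (opNorm P)⁻¹ * inner ℝ x (act P x) ≤ ‖x‖ ^ 2 := by
      rw [inv_mul_eq_div, div_le_iff₀ h]; linarith
    linarith

end Weighted

/-! ### One homogeneous step in the weighted norm -/

section Step

variable {Z : Type*} {d : ℕ} {A : Z → Matrix (Fin d) (Fin d) ℝ} {α K : ℝ}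
  {R : EuclideanSpace ℝ (Fin d) →L[ℝ] EuclideanSpace ℝ (Fin d)}

theorem lsaStep_zero_eq (z : Z) (y : EuclideanSpace ℝ (Fin d)) :
    lsaStep A 0 α z y = y - α • act (A z) y := by
  simp [lsaStep, act]

theorem abs_inner_act_le (hK : ∀ z x, ‖R (act (A z) x)‖ ≤ K * ‖R x‖)
    (x y : EuclideanSpace ℝ (Fin d)) (z : Z) :
    |inner ℝ (R x) (R (act (A z) y))| ≤ K * ‖R x‖ * ‖R y‖ := by
  refine (abs_real_inner_le_norm _ _).trans ?_
  have := mul_le_mul_of_nonneg_left (hK z y) (norm_nonneg (R x))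
  linarith

theorem norm_lsaStep_sub_le (hα : 0 ≤ α) (hK : ∀ z x, ‖R (act (A z) x)‖ ≤ K * ‖R x‖)
    (z : Z) (y : EuclideanSpace ℝ (Fin d)) :
    ‖R (lsaStep A 0 α z y - y)‖ ≤ α * K * ‖R y‖ := by
  rw [lsaStep_zero_eq, sub_sub_cancel_left, map_neg, norm_neg, map_smul, norm_smul,
    Real.norm_of_nonneg hα, mul_assoc]
  exact mul_le_mul_of_nonneg_left (hK z y) hα

theorem norm_lsaStep_le (hα : 0 ≤ α) (hK : ∀ z x, ‖R (act (A z) x)‖ ≤ K * ‖R x‖)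
    (z : Z) (y : EuclideanSpace ℝ (Fin d)) :
    ‖R (lsaStep A 0 α z y)‖ ≤ (1 + α * K) * ‖R y‖ := by
  have h := norm_lsaStep_sub_le hα hK z y
  have h2 : R (lsaStep A 0 α z y) = R (lsaStep A 0 α z y - y) + R y := by
    rw [← map_add, sub_add_cancel]
  rw [h2]
  linarith [norm_add_le (R (lsaStep A 0 α z y - y)) (R y)]

theorem norm_sq_lsaStep_le (hα : 0 ≤ α) (hK : ∀ z x, ‖R (act (A z) x)‖ ≤ K * ‖R x‖)
    (z : Z) (y : EuclideanSpace ℝ (Fin d)) :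
    ‖R (lsaStep A 0 α z y)‖ ^ 2 ≤
      (1 + (α * K) ^ 2) * ‖R y‖ ^ 2 - 2 * α * inner ℝ (R y) (R (act (A z) y)) := by
  rw [lsaStep_zero_eq, map_sub, map_smul, norm_sub_sq_real, inner_smul_right, norm_smul,
    Real.norm_of_nonneg hα]
  have : (α * ‖R (act (A z) y)‖) ^ 2 ≤ (α * (K * ‖R y‖)) ^ 2 :=
    pow_le_pow_left₀ (by positivity) (mul_le_mul_of_nonneg_left (hK z y) hα) 2
  nlinarith

/-- The price of keeping the quadratic form at `y` although the iterate has moved: one step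
displaces `y` by at most `α K ‖R y‖`. -/
theorem inner_act_sub_le (hα : 0 ≤ α) (hK0 : 0 ≤ K) (hK : ∀ z x, ‖R (act (A z) x)‖ ≤ K * ‖R x‖)
    (z z' : Z) (y : EuclideanSpace ℝ (Fin d)) :
    inner ℝ (R y) (R (act (A z') y)) - inner ℝ (R (lsaStep A 0 α z y))
      (R (act (A z') (lsaStep A 0 α z y))) ≤ K * (α * K) * (2 + α * K) * ‖R y‖ ^ 2 := by
  set y' := lsaStep A 0 α z y with hy'
  have h1 := norm_lsaStep_sub_le hα hK z y
  have h2 := norm_lsaStep_le hα hK z y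
  rw [← hy'] at h1 h2
  have e : inner ℝ (R y) (R (act (A z') y)) - inner ℝ (R y') (R (act (A z') y')) =
      -(inner ℝ (R (y' - y)) (R (act (A z') y')) + inner ℝ (R y) (R (act (A z') (y' - y)))) := by
    simp only [map_sub, inner_sub_left, inner_sub_right]; ring
  rw [e]
  have h3 := abs_inner_act_le hK (y' - y) y' z'
  have h4 := abs_inner_act_le hK y (y' - y) z'
  have h5 : K * ‖R (y' - y)‖ * ‖R y'‖ ≤ K * (α * K * ‖R y‖) * ((1 + α * K) * ‖R y‖) := by
    gcongr
  have h6 : K * ‖R y‖ * ‖R (y' - y)‖ ≤ K * ‖R y‖ * (α * K * ‖R y‖) := by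
    gcongr
  linarith [neg_abs_le (inner ℝ (R (y' - y)) (R (act (A z') y'))),
    neg_abs_le (inner ℝ (R y) (R (act (A z') (y' - y))))]

end Step

/-! ### The joint kernel and its iterates -/

section Joint

variable {Z : Type*} [MeasurableSpace Z] {d : ℕ} {Q : Kernel Z Z} [IsMarkovKernel Q]
  {A : Z → Matrix (Fin d) (Fin d) ℝ} {b : Z → EuclideanSpace ℝ (Fin d)} {α : ℝ}

theorem isMarkovKernel_jointKernel (hA : ∀ i j, Measurable fun z => A z i j) (hb : Measurable b) :
    IsMarkovKernel (jointKernel Q A b α) := by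
  have hm := measurable_lsaStep A b α hA hb
  exact Kernel.IsMarkovKernel.map _
    ((hm.comp (measurable_snd.prodMk measurable_fst.fst)).prodMk measurable_snd)

theorem measurable_act (hA : ∀ i j, Measurable fun z => A z i j) (y : EuclideanSpace ℝ (Fin d)) :
    Measurable fun z => act (A z) y := by
  -- With step size `-1` and `b = 0` the recursion map is `y ↦ y + A(z) y`.
  have h := (measurable_lsaStep A 0 (-1) hA measurable_zero).comp
    (measurable_id.prodMk (measurable_const (a := y)))
  have h2 : (fun z => act (A z) y) = fun z => lsaStep A 0 (-1) z y - y := by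
    ext1 z
    simp [lsaStep, act]
  rw [h2]
  exact h.sub_const y

theorem lintegral_jointKernel_pow_succ (hA : ∀ i j, Measurable fun z => A z i j)
    (hb : Measurable b) (n : ℕ) {f : EuclideanSpace ℝ (Fin d) × Z → ℝ≥0∞} (hf : Measurable f)
    (θ : EuclideanSpace ℝ (Fin d)) (z : Z) :
    ∫⁻ w, f w ∂(jointKernel Q A b α ^ (n + 1)) (θ, z) =
      ∫⁻ z', ∫⁻ w, f w ∂(jointKernel Q A b α ^ n) (lsaStep A b α z' θ, z') ∂Q z := by
  rw [pow_succ]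
  change ∫⁻ w, f w ∂((jointKernel Q A b α ^ n) ∘ₖ jointKernel Q A b α) (θ, z) = _
  rw [Kernel.lintegral_comp _ _ _ hf, lintegral_jointKernel Q A b α hA hb _ hf.lintegral_kernel]

end Joint

/-! ### Second moment over a block, with frozen linear term -/

section Block

variable {Z : Type*} [MeasurableSpace Z] {d : ℕ} {Q : Kernel Z Z} [IsMarkovKernel Q]
  {A : Z → Matrix (Fin d) (Fin d) ℝ} {α K : ℝ}
  {R : EuclideanSpace ℝ (Fin d) →L[ℝ] EuclideanSpace ℝ (Fin d)}

theorem measurable_inner_act (hA : ∀ i j, Measurable fun z => A z i j)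
    (y : EuclideanSpace ℝ (Fin d)) :
    Measurable fun z => inner ℝ (R y) (R (act (A z) y)) :=
  measurable_const.inner (R.continuous.measurable.comp (measurable_act hA y))

theorem integrable_inner_act (hA : ∀ i j, Measurable fun z => A z i j)
    (hK : ∀ z x, ‖R (act (A z) x)‖ ≤ K * ‖R x‖) (y : EuclideanSpace ℝ (Fin d))
    (ρ : Measure Z) [IsFiniteMeasure ρ] :
    Integrable (fun z => inner ℝ (R y) (R (act (A z) y))) ρ :=
  Integrable.of_bound (measurable_inner_act hA y).aestronglyMeasurable _
    (ae_of_all _ fun z => abs_inner_act_le hK y y z)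

theorem integral_inner_act_pow_succ (hA : ∀ i j, Measurable fun z => A z i j)
    (hK : ∀ z x, ‖R (act (A z) x)‖ ≤ K * ‖R x‖) (y : EuclideanSpace ℝ (Fin d)) (l : ℕ) (z : Z) :
    ∫ x, inner ℝ (R y) (R (act (A x) y)) ∂(Q ^ (l + 1)) z =
      ∫ z', ∫ x, inner ℝ (R y) (R (act (A x) y)) ∂(Q ^ l) z' ∂Q z := by
  rw [pow_succ]
  change ∫ x, _ ∂((Q ^ l) ∘ₖ Q) z = _
  exact Kernel.integral_comp (integrable_inner_act hA hK y _)

theorem abs_integral_inner_act_le (hK : ∀ z x, ‖R (act (A z) x)‖ ≤ K * ‖R x‖)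
    (y : EuclideanSpace ℝ (Fin d)) (ρ : Measure Z) [IsProbabilityMeasure ρ] :
    |∫ x, inner ℝ (R y) (R (act (A x) y)) ∂ρ| ≤ K * ‖R y‖ ^ 2 := by
  have := abs_integral_le_of_abs_le ρ (fun z => abs_inner_act_le hK y y z)
  rwa [measure_univ, ENNReal.toReal_one, mul_one, mul_assoc, ← sq] at this

/-- Condition on the first step. The induction hypothesis from `(y', z')` has its linear term frozen
at `y'`; moving it back to `y` costs a multiple of `α K²` for each of the `j` terms, so the
accumulated error stays quadratic in `j α K`. -/
theorem lintegral_norm_sq_pow_le (hA : ∀ i j, Measurable fun z => A z i j)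
    (hα : 0 ≤ α) (hK0 : 0 ≤ K) (hK : ∀ z x, ‖R (act (A z) x)‖ ≤ K * ‖R x‖)
    {h : ℕ} (hh : h * (α * K) ≤ 1 / 96) (j : ℕ) (hj : j ≤ h)
    (y : EuclideanSpace ℝ (Fin d)) (z : Z) :
    ∫⁻ w, ENNReal.ofReal (‖R w.1‖ ^ 2) ∂(jointKernel Q A 0 α ^ j) (y, z) ≤
      ENNReal.ofReal ((1 + 4 * (α * K) ^ 2 * j ^ 2) * ‖R y‖ ^ 2 -
        2 * α * ∑ l ∈ Finset.range j,
          ∫ x, inner ℝ (R y) (R (act (A x) y)) ∂(Q ^ (l + 1)) z) := by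
  have hmV : Measurable fun w : EuclideanSpace ℝ (Fin d) × Z => ENNReal.ofReal (‖R w.1‖ ^ 2) :=
    ((R.continuous.measurable.comp measurable_fst).norm.pow_const 2).ennreal_ofReal
  induction j generalizing y z with
  | zero =>
    rw [pow_zero]
    change ∫⁻ w, ENNReal.ofReal (‖R w.1‖ ^ 2) ∂Kernel.id (y, z) ≤ _
    rw [Kernel.id_apply, lintegral_dirac' _ hmV]
    simp
  | succ j ih =>
    rw [lintegral_jointKernel_pow_succ hA measurable_zero j hmV]
    set β := α * K with hβ
    have hβ0 : 0 ≤ β := mul_nonneg hα hK0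
    have hjβ : ((j : ℝ) + 1) * β ≤ 1 / 96 := by
      refine le_trans ?_ hh
      have : ((j + 1 : ℕ) : ℝ) ≤ h := by exact_mod_cast hj
      push_cast at this
      gcongr
    have hj0 : (0 : ℝ) ≤ j := Nat.cast_nonneg j
    set v := ‖R y‖ ^ 2 with hv
    have hv0 : 0 ≤ v := sq_nonneg _
    set g : Z → ℝ := fun x => inner ℝ (R y) (R (act (A x) y)) with hg
    set S' : Z → ℝ := fun z' => ∑ l ∈ Finset.range j, ∫ x, g x ∂(Q ^ (l + 1)) z' with hS'
    set B : Z → ℝ := fun z' =>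
      (1 + 4 * β ^ 2 * ((j : ℝ) + 1) ^ 2) * v - 2 * α * (g z' + S' z') with hB
    have hgm : Measurable g := measurable_inner_act hA y
    have hint : ∀ l : ℕ, Integrable (fun z' => ∫ x, g x ∂(Q ^ l) z') (Q z) := fun l =>
      Integrable.of_bound hgm.stronglyMeasurable.integral_kernel.aestronglyMeasurable _
        (ae_of_all _ fun z' => abs_integral_inner_act_le hK y ((Q ^ l) z'))
    have hintg : Integrable g (Q z) := integrable_inner_act hA hK y _
    have hintS : Integrable S' (Q z) := integrable_finsetSum _ fun l _ => hint (l + 1)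
    have hSb : ∀ z', |S' z'| ≤ j * (K * v) := by
      intro z'
      refine (Finset.abs_sum_le_sum_abs _ _).trans ?_
      refine (Finset.sum_le_card_nsmul _ _ (K * v)
        fun l _ => abs_integral_inner_act_le hK y ((Q ^ (l + 1)) z')).trans ?_
      simp
    -- The bound must be nonnegative for every `z'`, not just on average, so that `ENNReal.ofReal`
    -- commutes with the integral over `z'`.
    have hB0 : ∀ z', 0 ≤ B z' := by
      intro z'
      have h1 := hSb z'
      have h2 : |g z'| ≤ K * v := by
        have := abs_inner_act_le hK y y z'
        rwa [mul_assoc, ← sq] at this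
      have h3 : 2 * α * (g z' + S' z') ≤ 2 * α * ((j + 1) * (K * v)) := by
        refine mul_le_mul_of_nonneg_left ?_ (by positivity)
        linarith [le_abs_self (g z'), le_abs_self (S' z')]
      have h4 : 2 * α * ((j + 1) * (K * v)) = 2 * (((j : ℝ) + 1) * β) * v := by rw [hβ]; ring
      have h5 : 2 * (((j : ℝ) + 1) * β) * v ≤ 1 * v :=
        mul_le_mul_of_nonneg_right (by linarith) hv0
      have h6 : 0 ≤ 4 * β ^ 2 * ((j : ℝ) + 1) ^ 2 * v := by positivity
      simp only [hB]
      linarith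
    have hpt : ∀ z', ∫⁻ w, ENNReal.ofReal (‖R w.1‖ ^ 2)
        ∂(jointKernel Q A 0 α ^ j) (lsaStep A 0 α z' y, z') ≤ ENNReal.ofReal (B z') := by
      intro z'
      refine (ih (by omega) _ _).trans (ENNReal.ofReal_le_ofReal ?_)
      set y' := lsaStep A 0 α z' y with hy'
      have h1 : ‖R y'‖ ^ 2 ≤ (1 + β ^ 2) * v - 2 * α * g z' := norm_sq_lsaStep_le hα hK z' y
      have h2 : ‖R y'‖ ^ 2 ≤ (1 + β) ^ 2 * v := by
        rw [hv, ← mul_pow]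
        exact pow_le_pow_left₀ (norm_nonneg _) (norm_lsaStep_le hα hK z' y) 2
      have h3 : S' z' - ∑ l ∈ Finset.range j,
          ∫ x, inner ℝ (R y') (R (act (A x) y')) ∂(Q ^ (l + 1)) z' ≤
          j * (K * β * (2 + β) * v) := by
        rw [hS', ← Finset.sum_sub_distrib]
        refine (Finset.sum_le_card_nsmul _ _ (K * β * (2 + β) * v) fun l _ => ?_).trans (by simp)
        rw [← integral_sub (integrable_inner_act hA hK y _) (integrable_inner_act hA hK y' _)]
        refine (integral_mono ((integrable_inner_act hA hK y _).sub
          (integrable_inner_act hA hK y' _)) (integrable_const (K * β * (2 + β) * v))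
          fun x => inner_act_sub_le hα hK0 hK z' x y).trans ?_
        simp
      have h3' := mul_le_mul_of_nonneg_left h3 (by positivity : 0 ≤ 2 * α)
      have h4 : 2 * α * (j * (K * β * (2 + β) * v)) = 2 * j * β ^ 2 * (2 + β) * v := by
        rw [hβ]; ring
      have h5 : 4 * β ^ 2 * (j : ℝ) ^ 2 * ‖R y'‖ ^ 2 ≤
          4 * β ^ 2 * (j : ℝ) ^ 2 * ((1 + β) ^ 2 * v) :=
        mul_le_mul_of_nonneg_left h2 (by positivity)
      have hβ1 : β ≤ 1 / 96 := by nlinarith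
      -- The three errors are the quadratic term of the first step, the inherited error amplified by
      -- that step, and the refreezing cost. Going from `4 j²` to `4 (j + 1)²` leaves room for them
      -- because `j β ≤ 1/96`.
      have h6 : β ^ 2 + 4 * β ^ 2 * (j : ℝ) ^ 2 * (1 + β) ^ 2 + 2 * j * β ^ 2 * (2 + β) ≤
          4 * β ^ 2 * ((j : ℝ) + 1) ^ 2 := by
        have e : 4 * β ^ 2 * ((j : ℝ) + 1) ^ 2 - (β ^ 2 + 4 * β ^ 2 * (j : ℝ) ^ 2 * (1 + β) ^ 2 +
            2 * j * β ^ 2 * (2 + β)) =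
            β ^ 2 * (3 + 4 * j - 2 * j * β - 4 * j * (j * β) * (2 + β)) := by ring
        have h7 : (j : ℝ) * β ≤ 1 / 96 := by nlinarith
        have h8 : (j * β) * (2 + β) ≤ 1 / 96 * 3 := by
          have : 0 ≤ j * β := by positivity
          gcongr; linarith
        have h9 : 0 ≤ 3 + 4 * j - 2 * j * β - 4 * j * (j * β) * (2 + β) := by
          nlinarith [mul_le_mul_of_nonneg_left h8 hj0]
        have := mul_nonneg (sq_nonneg β) h9
        linarith
      have h6' := mul_le_mul_of_nonneg_right h6 hv0
      simp only [hB]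
      linarith
    refine (lintegral_mono hpt).trans ?_
    rw [← ofReal_integral_eq_lintegral_ofReal ?_ (ae_of_all _ hB0)]
    · refine ENNReal.ofReal_le_ofReal (le_of_eq ?_)
      have e1 : ∫ z', g z' + S' z' ∂Q z = ∑ l ∈ Finset.range (j + 1), ∫ x, g x ∂(Q ^ (l + 1)) z := by
        rw [integral_add hintg hintS, hS', integral_finsetSum _ fun l _ => hint (l + 1),
          Finset.sum_range_succ', zero_add, pow_one, add_comm]
        congr 1
        exact Finset.sum_congr rfl fun l _ => (integral_inner_act_pow_succ hA hK y (l + 1) z).symm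
      have e2 : Integrable (fun z' => 2 * α * (g z' + S' z')) (Q z) :=
        (hintg.add hintS).const_mul _
      have e3 : ∫ z', 2 * α * (g z' + S' z') ∂Q z =
          2 * α * ∑ l ∈ Finset.range (j + 1), ∫ x, g x ∂(Q ^ (l + 1)) z := by
        rw [integral_const_mul, e1]
      simp only [hB]
      rw [integral_sub (integrable_const _) e2, e3]
      simp
    · exact (integrable_const _).sub ((hintg.add hintS).const_mul _)

end Block

/-! ### Summability from a block contraction -/

theorem lintegral_pow_add {S : Type*} [MeasurableSpace S] (H : Kernel S S) {φ : S → ℝ≥0∞}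
    (hφ : Measurable φ) (m n : ℕ) (w : S) :
    ∫⁻ x, φ x ∂(H ^ (m + n)) w = ∫⁻ y, ∫⁻ x, φ x ∂(H ^ n) y ∂(H ^ m) w := by
  rw [add_comm, pow_add]
  change ∫⁻ x, φ x ∂((H ^ n) ∘ₖ (H ^ m)) w = _
  exact Kernel.lintegral_comp _ _ _ hφ

theorem lintegral_pow_zero {S : Type*} [MeasurableSpace S] (H : Kernel S S) {φ : S → ℝ≥0∞}
    (hφ : Measurable φ) (w : S) : ∫⁻ x, φ x ∂(H ^ 0) w = φ w := by
  rw [pow_zero]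
  change ∫⁻ x, φ x ∂Kernel.id w = _
  rw [Kernel.id_apply, lintegral_dirac' _ hφ]

/-- Peel off one block: its `h` terms cost `C₀ φ`, and the tail restarts from a state where `φ` has
shrunk by `ρ` on average. The constant `C = C₀ / (1 - ρ)` is the fixed point of `C₀ + ρ C = C`.
Inducting on partial sums avoids presupposing finiteness. -/
theorem exists_tsum_lintegral_pow_le {S : Type*} [MeasurableSpace S] (H : Kernel S S)
    {φ : S → ℝ≥0∞} (hφ : Measurable φ) {c ρ : ℝ≥0∞} (hc : c ≠ ∞) (hρ : ρ < 1)
    (hstep : ∀ w, ∫⁻ x, φ x ∂H w ≤ c * φ w) {h : ℕ} (hh : 1 ≤ h)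
    (hblock : ∀ w, ∫⁻ x, φ x ∂(H ^ h) w ≤ ρ * φ w) :
    ∃ C : ℝ≥0∞, C ≠ ∞ ∧ ∀ w, ∑' n, ∫⁻ x, φ x ∂(H ^ n) w ≤ C * φ w := by
  have hpow : ∀ n w, ∫⁻ x, φ x ∂(H ^ n) w ≤ c ^ n * φ w := by
    intro n w
    induction n with
    | zero => rw [lintegral_pow_zero H hφ]; simp
    | succ n ih =>
      rw [lintegral_pow_add H hφ]
      calc _ ≤ ∫⁻ y, c * φ y ∂(H ^ n) w := lintegral_mono fun y => by rw [pow_one]; exact hstep y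
        _ = c * ∫⁻ y, φ y ∂(H ^ n) w := lintegral_const_mul _ hφ
        _ ≤ c * (c ^ n * φ w) := by gcongr
        _ = _ := by rw [pow_succ]; ring
  set C₀ : ℝ≥0∞ := ∑ n ∈ Finset.range h, c ^ n with hC₀
  set C : ℝ≥0∞ := C₀ * (1 - ρ)⁻¹ with hC
  have hρ0 : 1 - ρ ≠ 0 := (tsub_pos_of_lt hρ).ne'
  have hC₀t : C₀ ≠ ∞ := by
    rw [hC₀]; exact ENNReal.sum_ne_top.2 fun n _ => ENNReal.pow_ne_top hc
  have hCC : C₀ + C * ρ = C := by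
    have h1 : C * (1 - ρ) = C₀ := by
      rw [hC, mul_assoc, ENNReal.inv_mul_cancel hρ0 (by finiteness), mul_one]
    calc _ = C * (1 - ρ) + C * ρ := by rw [h1]
      _ = C := by rw [← mul_add, tsub_add_cancel_of_le hρ.le, mul_one]
  have hC₀w : ∀ w, ∑ n ∈ Finset.range h, ∫⁻ x, φ x ∂(H ^ n) w ≤ C₀ * φ w := by
    intro w
    rw [hC₀, Finset.sum_mul]
    exact Finset.sum_le_sum fun n _ => hpow n w
  refine ⟨C, ENNReal.mul_ne_top hC₀t (ENNReal.inv_ne_top.2 hρ0), fun w => ?_⟩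
  refine ENNReal.tsum_le_of_sum_range_le fun M => ?_
  induction M using Nat.strong_induction_on generalizing w with
  | _ M ih =>
    rcases le_total M h with hM | hM
    · calc _ ≤ ∑ n ∈ Finset.range h, ∫⁻ x, φ x ∂(H ^ n) w :=
            Finset.sum_le_sum_of_subset (Finset.range_mono hM)
        _ ≤ C₀ * φ w := hC₀w w
        _ ≤ C * φ w := by gcongr; rw [← hCC]; exact le_self_add
    · obtain ⟨M', rfl⟩ := Nat.exists_eq_add_of_le hM
      rw [Finset.sum_range_add]
      calc _ ≤ C₀ * φ w + ∫⁻ y, C * φ y ∂(H ^ h) w := by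
            refine add_le_add (hC₀w w) ?_
            simp_rw [lintegral_pow_add H hφ]
            rw [← lintegral_finsetSum _ fun n _ => hφ.lintegral_kernel]
            exact lintegral_mono fun y => ih M' (by omega) y
        _ ≤ C₀ * φ w + C * (ρ * φ w) := by
            rw [lintegral_const_mul _ hφ]; gcongr; exact hblock w
        _ = C * φ w := by rw [← mul_assoc, ← add_mul, hCC]

/-! ### Contraction of the homogeneous recursion -/

section Contraction

variable {Z : Type*} [MeasurableSpace Z] {d : ℕ} {Q : Kernel Z Z} [IsMarkovKernel Q]
  {π : Measure Z} [IsProbabilityMeasure π] {t N : ℕ}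
  {A : Z → Matrix (Fin d) (Fin d) ℝ} {α K a : ℝ}
  {R : EuclideanSpace ℝ (Fin d) →L[ℝ] EuclideanSpace ℝ (Fin d)}

/-- Write `h = N * t` and `v = ‖R y‖²`. The stationary drift contributes `-2 h α a v`. The mixing
error is at most `2α · (8/3) t K v`, which `8 K ≤ a N` bounds by `(2/3) h α a v`; the freezing error
is at most `h α a v / 24`. The total is below `-h α a v`. -/
theorem lintegral_norm_sq_block_le (hπ : Kernel.Invariant Q π) (ht : 1 ≤ t)
    (hmix : ∀ k : ℕ, 1 ≤ k → dobrushin (Q ^ k) ≤ (1 / 4 : ℝ≥0∞) ^ (k / t))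
    (hA : ∀ i j, Measurable fun z => A z i j)
    (hα : 0 ≤ α) (hK0 : 0 ≤ K) (hK : ∀ z x, ‖R (act (A z) x)‖ ≤ K * ‖R x‖)
    (hdrift : ∀ y, a * ‖R y‖ ^ 2 ≤ ∫ x, inner ℝ (R y) (R (act (A x) y)) ∂π)
    (hN : 8 * K ≤ a * N) (hh : (N * t : ℕ) * (α * K) ≤ 1 / 96)
    (hh' : 96 * (((N * t : ℕ) * α) * K ^ 2) ≤ a)
    (y : EuclideanSpace ℝ (Fin d)) (z : Z) :
    ∫⁻ w, ENNReal.ofReal (‖R w.1‖ ^ 2) ∂(jointKernel Q A 0 α ^ (N * t)) (y, z) ≤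
      ENNReal.ofReal ((1 - (N * t : ℕ) * α * a) * ‖R y‖ ^ 2) := by
  refine (lintegral_norm_sq_pow_le hA hα hK0 hK hh _ le_rfl y z).trans
    (ENNReal.ofReal_le_ofReal ?_)
  set v := ‖R y‖ ^ 2 with hv
  have hv0 : 0 ≤ v := sq_nonneg _
  have ha0 : 0 ≤ a := le_trans (by positivity) hh'
  have hsum : (N * t : ℕ) * (a * v) - 8 / 3 * (t * (K * v)) ≤ ∑ l ∈ Finset.range (N * t),
      ∫ x, inner ℝ (R y) (R (act (A x) y)) ∂(Q ^ (l + 1)) z := by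
    have h1 : ∀ l ∈ Finset.range (N * t), a * v - 2 * (K * v) * (1 / 4 : ℝ) ^ ((l + 1) / t) ≤
        ∫ x, inner ℝ (R y) (R (act (A x) y)) ∂(Q ^ (l + 1)) z := by
      intro l _
      have h2 := abs_integral_pow_sub_integral_le hπ hmix (measurable_inner_act (R := R) hA y)
        (M := K * v) (by positivity)
        (fun x => (abs_inner_act_le hK y y x).trans_eq (by rw [hv]; ring))
        (Nat.le_add_left 1 l) z
      linarith [hdrift y, neg_le_of_abs_le h2]
    refine le_trans ?_ (Finset.sum_le_sum h1)
    rw [Finset.sum_sub_distrib, Finset.sum_const, Finset.card_range, nsmul_eq_mul,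
      ← Finset.mul_sum]
    have h3 := mul_le_mul_of_nonneg_left (sum_quarter_pow_div_le ht N)
      (by positivity : 0 ≤ 2 * (K * v))
    linarith
  have h1 := mul_le_mul_of_nonneg_left hsum (by positivity : 0 ≤ 2 * α)
  have h2 : 4 * (α * K) ^ 2 * (N * t : ℕ) ^ 2 * v ≤ (N * t : ℕ) * α * a * v / 24 := by
    have := mul_le_mul_of_nonneg_right hh' (by positivity : 0 ≤ (N * t : ℕ) * α * v)
    nlinarith
  have h3 : 8 * K * (t * α * v) ≤ a * N * (t * α * v) :=
    mul_le_mul_of_nonneg_right hN (by positivity)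
  have h4 : 0 ≤ (N * t : ℕ) * α * a * v := by positivity
  push_cast at *
  linarith

/-- First moments suffice later. With `s = ‖R y‖`, integrate `r ≤ r² / (2 s) + s / 2`; this gives
`(1 + ρ) / 2` in place of the `√ρ` of Jensen's inequality. The case `s = 0` needs a separate
argument. -/
theorem lintegral_enorm_block_le (hA : ∀ i j, Measurable fun z => A z i j) {n : ℕ} {ρ : ℝ}
    (hρ : 0 ≤ ρ) (y : EuclideanSpace ℝ (Fin d)) (z : Z)
    (h : ∫⁻ w, ENNReal.ofReal (‖R w.1‖ ^ 2) ∂(jointKernel Q A 0 α ^ n) (y, z) ≤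
      ENNReal.ofReal (ρ * ‖R y‖ ^ 2)) :
    ∫⁻ w, ‖R w.1‖ₑ ∂(jointKernel Q A 0 α ^ n) (y, z) ≤
      ENNReal.ofReal ((1 + ρ) / 2) * ‖R y‖ₑ := by
  have hmk : IsMarkovKernel (jointKernel Q A 0 α) := isMarkovKernel_jointKernel hA measurable_zero
  have hmR : Measurable fun w : EuclideanSpace ℝ (Fin d) × Z => R w.1 :=
    R.continuous.measurable.comp measurable_fst
  have hmV : Measurable fun w : EuclideanSpace ℝ (Fin d) × Z => ENNReal.ofReal (‖R w.1‖ ^ 2) :=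
    (hmR.norm.pow_const 2).ennreal_ofReal
  rcases (norm_nonneg (R y)).eq_or_lt with hs | hs
  · rw [← hs] at h
    simp only [ne_eq, OfNat.ofNat_ne_zero, not_false_eq_true, zero_pow, mul_zero,
      ENNReal.ofReal_zero, nonpos_iff_eq_zero] at h
    rw [lintegral_eq_zero_iff hmV] at h
    have : ∫⁻ w, ‖R w.1‖ₑ ∂(jointKernel Q A 0 α ^ n) (y, z) = 0 := by
      rw [lintegral_eq_zero_iff hmR.enorm]
      filter_upwards [h] with w hw
      simp only [Pi.zero_apply, ENNReal.ofReal_eq_zero] at hw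
      have : ‖R w.1‖ = 0 := pow_eq_zero_iff two_ne_zero |>.1 (le_antisymm hw (sq_nonneg _))
      simpa using this
    rw [this]
    exact zero_le
  · set s := ‖R y‖ with hsdef
    calc ∫⁻ w, ‖R w.1‖ₑ ∂(jointKernel Q A 0 α ^ n) (y, z)
        ≤ ∫⁻ w, (ENNReal.ofReal (2 * s)⁻¹ * ENNReal.ofReal (‖R w.1‖ ^ 2) +
            ENNReal.ofReal (s / 2)) ∂(jointKernel Q A 0 α ^ n) (y, z) := by
          refine lintegral_mono fun w => ?_
          rw [← ofReal_norm, ← ENNReal.ofReal_mul (by positivity),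
            ← ENNReal.ofReal_add (by positivity) (by positivity)]
          refine ENNReal.ofReal_le_ofReal ?_
          have : (2 * s)⁻¹ * ‖R w.1‖ ^ 2 + s / 2 - ‖R w.1‖ = (2 * s)⁻¹ * (‖R w.1‖ - s) ^ 2 := by
            field_simp; ring
          have h2 : 0 ≤ (2 * s)⁻¹ * (‖R w.1‖ - s) ^ 2 := by positivity
          linarith
      _ ≤ ENNReal.ofReal (2 * s)⁻¹ * ENNReal.ofReal (ρ * s ^ 2) + ENNReal.ofReal (s / 2) := by
          rw [lintegral_add_right _ measurable_const, lintegral_const_mul _ hmV, lintegral_const,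
            measure_univ, mul_one]
          gcongr
      _ = _ := by
          rw [← ofReal_norm, ← ENNReal.ofReal_mul (by positivity),
            ← ENNReal.ofReal_add (by positivity) (by positivity),
            ← ENNReal.ofReal_mul (by positivity)]
          congr 1
          field_simp; ring

theorem exists_tsum_lintegral_enorm_le (hπ : Kernel.Invariant Q π) (ht : 1 ≤ t)
    (hmix : ∀ k : ℕ, 1 ≤ k → dobrushin (Q ^ k) ≤ (1 / 4 : ℝ≥0∞) ^ (k / t))
    (hA : ∀ i j, Measurable fun z => A z i j)
    (hα : 0 < α) (ha : 0 < a) (haK : a ≤ K) (hK : ∀ z x, ‖R (act (A z) x)‖ ≤ K * ‖R x‖)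
    (hdrift : ∀ y, a * ‖R y‖ ^ 2 ≤ ∫ x, inner ℝ (R y) (R (act (A x) y)) ∂π)
    (hN : 8 * K ≤ a * N) (hh : 96 * (((N * t : ℕ) * α) * K ^ 2) ≤ a)
    {c : ℝ} (hR : ∀ x, ‖x‖ ≤ c * ‖R x‖) :
    ∃ C : ℝ≥0∞, C ≠ ∞ ∧ ∀ (y : EuclideanSpace ℝ (Fin d)) (z : Z),
      ∑' n, ∫⁻ w, ‖w.1‖ₑ ∂(jointKernel Q A 0 α ^ n) (y, z) ≤ C * ‖y‖ₑ := by
  have hK0 : 0 < K := ha.trans_le haK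
  have hNt : 1 ≤ N * t := by
    have : N ≠ 0 := by rintro rfl; simp at hN; linarith
    exact Nat.mul_pos (by omega) (by omega)
  have hNt' : (1 : ℝ) ≤ (N * t : ℕ) := by exact_mod_cast hNt
  -- Because `a ≤ K`, one factor `K` cancels in `hh`.
  have hh1 : (N * t : ℕ) * (α * K) ≤ 1 / 96 := by
    have : 96 * (((N * t : ℕ) * (α * K)) * K) ≤ 1 * K := by nlinarith
    have := le_of_mul_le_mul_right (by linarith : 96 * ((N * t : ℕ) * (α * K)) * K ≤ 1 * K) hK0
    linarith
  have hpos : 0 < (N * t : ℕ) * α * a := by positivity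
  have hle : (N * t : ℕ) * α * a ≤ 1 := by
    have : (N * t : ℕ) * α * a ≤ (N * t : ℕ) * α * K := by gcongr
    linarith
  have hmR : Measurable fun w : EuclideanSpace ℝ (Fin d) × Z => ‖R w.1‖ₑ :=
    (R.continuous.measurable.comp measurable_fst).enorm
  obtain ⟨C, hC, hCw⟩ := exists_tsum_lintegral_pow_le (jointKernel Q A 0 α) hmR
    (c := ENNReal.ofReal (1 + α * K)) (ρ := ENNReal.ofReal ((1 + (1 - (N * t : ℕ) * α * a)) / 2))
    ENNReal.ofReal_ne_top (by rw [ENNReal.ofReal_lt_one]; linarith)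
    (fun w => by
      rw [lintegral_jointKernel Q A 0 α hA measurable_zero _ hmR]
      refine (lintegral_mono (g := fun _ => ENNReal.ofReal (1 + α * K) * ‖R w.1‖ₑ)
        fun z' => ?_).trans (by simp)
      rw [← ofReal_norm, ← ofReal_norm, ← ENNReal.ofReal_mul (by positivity)]
      exact ENNReal.ofReal_le_ofReal (norm_lsaStep_le hα.le hK z' w.1)) hNt
    (fun w => lintegral_enorm_block_le hA (by linarith) w.1 w.2
      (lintegral_norm_sq_block_le hπ ht hmix hA hα.le hK0.le hK hdrift hN hh1 hh w.1 w.2))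
  refine ⟨ENNReal.ofReal c * (C * ‖(R : _ →L[ℝ] _)‖ₑ), by finiteness, fun y z => ?_⟩
  have h1 : ∀ x, ‖x‖ₑ ≤ ENNReal.ofReal c * ‖R x‖ₑ := by
    intro x
    rw [← ofReal_norm, ← ofReal_norm, ← ENNReal.ofReal_mul' (norm_nonneg _)]
    exact ENNReal.ofReal_le_ofReal (hR x)
  calc _ ≤ ∑' n, ENNReal.ofReal c * ∫⁻ w, ‖R w.1‖ₑ ∂(jointKernel Q A 0 α ^ n) (y, z) := by
        refine ENNReal.tsum_le_tsum fun n => ?_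
        rw [← lintegral_const_mul _ hmR]
        exact lintegral_mono fun w => h1 w.1
    _ ≤ ENNReal.ofReal c * (C * ‖R y‖ₑ) := by
        rw [ENNReal.tsum_mul_left]; gcongr; exact hCw (y, z)
    _ ≤ ENNReal.ofReal c * (C * (‖(R : _ →L[ℝ] _)‖ₑ * ‖y‖ₑ)) := by
        gcongr; exact R.le_opENorm y
    _ = _ := by ring

end Contraction

/-! ### Extending the stationary noise to the past -/

section Backward

theorem prod_eq_mul_prod_preimage_succ (s : Finset ℕ) (f : ℕ → ℝ≥0∞) :
    ∏ i ∈ s, f i = (if 0 ∈ s then f 0 else 1) *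
      ∏ i ∈ s.preimage Nat.succ Nat.succ_injective.injOn, f (i + 1) := by
  rw [← Finset.prod_filter_mul_prod_filter_not s (· = 0) f, Finset.filter_eq']
  congr 1
  · split_ifs <;> simp
  · classical
    rw [Finset.prod_preimage' Nat.succ s Nat.succ_injective.injOn f]
    refine Finset.prod_congr (Finset.filter_congr fun i _ => ?_) fun _ _ => rfl
    simp [Nat.range_succ, Nat.pos_iff_ne_zero]

theorem measurable_nat_cons {X : Type*} [MeasurableSpace X] :
    Measurable (fun p : X × (ℕ → X) => fun n : ℕ => (Nat.casesOn n p.1 p.2 : X)) := by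
  refine measurable_pi_lambda _ fun n => ?_
  cases n with
  | zero => exact measurable_fst
  | succ n => exact (measurable_pi_apply n).comp measurable_snd

/-- Prepending an independent draw to an i.i.d. sequence gives an i.i.d. sequence; it suffices to
compare finite boxes. -/
theorem infinitePi_eq_map_cons {X : Type*} [MeasurableSpace X] (μ : Measure X)
    [IsProbabilityMeasure μ] :
    (μ.prod (Measure.infinitePi fun _ : ℕ => μ)).map
      (fun p : X × (ℕ → X) => fun n : ℕ => (Nat.casesOn n p.1 p.2 : X)) =
      Measure.infinitePi fun _ : ℕ => μ := by
  have hm := measurable_nat_cons (X := X)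
  refine Measure.eq_infinitePi _ fun s t ht => ?_
  rw [Measure.map_apply hm (MeasurableSet.pi s.countable_toSet fun i _ => ht i)]
  have hpre : (fun p : X × (ℕ → X) => fun n : ℕ => (Nat.casesOn n p.1 p.2 : X)) ⁻¹'
      Set.pi s t = (if 0 ∈ s then t 0 else Set.univ) ×ˢ
        Set.pi (s.preimage Nat.succ Nat.succ_injective.injOn) (fun i => t (i + 1)) := by
    ext ⟨x, u⟩
    simp only [Set.mem_preimage, Set.mem_pi, Finset.mem_coe, Set.mem_prod, Finset.mem_preimage]
    constructor
    · intro h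
      refine ⟨?_, fun i hi => h (i + 1) hi⟩
      split_ifs with h0
      · exact h 0 h0
      · trivial
    · rintro ⟨h0, h1⟩ i hi
      cases i with
      | zero => simpa [hi] using h0
      | succ i => exact h1 i hi
  rw [hpre, Measure.prod_prod, Measure.infinitePi_pi _ fun i _ => ht _,
    prod_eq_mul_prod_preimage_succ s]
  congr 1
  split_ifs <;> simp

theorem lintegral_infinitePi_cons {X : Type*} [MeasurableSpace X] (μ : Measure X)
    [IsProbabilityMeasure μ] {F : X × (ℕ → X) → ℝ≥0∞} (hF : Measurable F) :
    ∫⁻ u, F (u 0, fun n => u (n + 1)) ∂(Measure.infinitePi fun _ : ℕ => μ) =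
      ∫⁻ x, ∫⁻ u, F (x, u) ∂(Measure.infinitePi fun _ : ℕ => μ) ∂μ := by
  have hm := measurable_nat_cons (X := X)
  have hm2 : Measurable fun u : ℕ → X => F (u 0, fun n => u (n + 1)) :=
    hF.comp ((measurable_pi_apply 0).prodMk
      (measurable_pi_lambda _ fun n => measurable_pi_apply (n + 1)))
  conv_lhs => rw [← infinitePi_eq_map_cons μ]
  rw [lintegral_map hm2 hm]
  exact lintegral_prod F hF.aemeasurable

/-- A stationary Markov chain extended to the past: `z₀ ω` is the current state and `τ ω` the
history up to the previous step. -/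
theorem exists_stationary_past {Z : Type*} [MeasurableSpace Z] [StandardBorelSpace Z]
    {Q : Kernel Z Z} [IsMarkovKernel Q] {π : Measure Z} [IsProbabilityMeasure π]
    (hπ : Kernel.Invariant Q π) :
    ∃ (m : Measure (Z × (ℕ → unitInterval))) (z₀ : Z × (ℕ → unitInterval) → Z)
      (τ : Z × (ℕ → unitInterval) → Z × (ℕ → unitInterval)),
      IsProbabilityMeasure m ∧ Measurable z₀ ∧ Measurable τ ∧
      ∀ φ : (Z × (ℕ → unitInterval)) × Z → ℝ≥0∞, Measurable φ →
        ∫⁻ ω, φ (τ ω, z₀ ω) ∂m = ∫⁻ ω, ∫⁻ z', φ (ω, z') ∂Q (z₀ ω) ∂m := by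
  have hne : Nonempty Z := π.nonempty_of_neZero
  -- The time-reversed kernel `Q†π` is realized as a function of the current state and a uniform
  -- variable. An i.i.d. sequence of uniforms then encodes the whole past, and `τ` spends one of
  -- them to step back.
  obtain ⟨f, hf, hfκ⟩ := Kernel.exists_measurable_map_eq_unitInterval (Q†π)
  set Λ : Measure (ℕ → unitInterval) := Measure.infinitePi fun _ : ℕ => volume with hΛ
  refine ⟨π.prod Λ, Prod.fst, fun ω => (f ω.1 (ω.2 0), fun n => ω.2 (n + 1)), inferInstance,
    measurable_fst, ?_, fun φ hφ => ?_⟩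
  · refine Measurable.prodMk (hf.comp (measurable_fst.prodMk
      ((measurable_pi_apply 0).comp measurable_snd))) ?_
    exact measurable_pi_lambda _ fun n => (measurable_pi_apply (n + 1)).comp measurable_snd
  have hτ : Measurable fun ω : Z × (ℕ → unitInterval) =>
      (((f ω.1 (ω.2 0), fun n => ω.2 (n + 1)), ω.1) : (Z × (ℕ → unitInterval)) × Z) := by
    refine Measurable.prodMk (Measurable.prodMk (hf.comp (measurable_fst.prodMk
      ((measurable_pi_apply 0).comp measurable_snd))) ?_) measurable_fst
    exact measurable_pi_lambda _ fun n => (measurable_pi_apply (n + 1)).comp measurable_snd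
  set Ψ : Z × Z → ℝ≥0∞ := fun p => ∫⁻ u, φ ((p.2, u), p.1) ∂Λ with hΨ
  have hΨm : Measurable Ψ := by
    refine Measurable.lintegral_prod_right' (f := fun q : (Z × Z) × (ℕ → unitInterval) =>
      φ ((q.1.2, q.2), q.1.1)) ?_
    exact hφ.comp (by fun_prop)
  -- Stationarity enters here: the second marginal of `π ⊗ₘ Q` is again `π`.
  have hrev : (π ⊗ₘ (Q†π)) = (π ⊗ₘ Q).map Prod.swap := by
    have h := compProd_posterior_eq_map_swap (κ := Q) (μ := π)
    rwa [hπ.def] at h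
  calc ∫⁻ ω, φ ((f ω.1 (ω.2 0), fun n => ω.2 (n + 1)), ω.1) ∂π.prod Λ
      = ∫⁻ z, ∫⁻ u, φ ((f z (u 0), fun n => u (n + 1)), z) ∂Λ ∂π :=
        lintegral_prod _ (hφ.comp hτ).aemeasurable
    _ = ∫⁻ z, ∫⁻ v, Ψ (z, f z v) ∂volume ∂π := by
        refine lintegral_congr fun z => ?_
        exact lintegral_infinitePi_cons volume
          (F := fun p => φ ((f z p.1, p.2), z)) (hφ.comp
            (((hf.comp (measurable_const.prodMk measurable_fst)).prodMk measurable_snd).prodMk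
              measurable_const))
    _ = ∫⁻ z, ∫⁻ z₁, Ψ (z, z₁) ∂(Q†π) z ∂π := by
        refine lintegral_congr fun z => ?_
        rw [← hfκ z]
        exact (lintegral_map (f := fun z₁ => Ψ (z, z₁)) (hΨm.comp measurable_prodMk_left)
          (hf.comp measurable_prodMk_left)).symm
    _ = ∫⁻ p, Ψ p ∂(π ⊗ₘ (Q†π)) := (Measure.lintegral_compProd hΨm).symm
    _ = ∫⁻ z₁, ∫⁻ z, Ψ (z, z₁) ∂Q z₁ ∂π := by
        rw [hrev, lintegral_map hΨm measurable_swap]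
        exact Measure.lintegral_compProd (hΨm.comp measurable_swap)
    _ = ∫⁻ z₁, ∫⁻ u, ∫⁻ z, φ ((z₁, u), z) ∂Q z₁ ∂Λ ∂π := by
        refine lintegral_congr fun z₁ => ?_
        exact lintegral_lintegral_swap (f := fun z u => φ ((z₁, u), z))
          (hφ.comp (by fun_prop)).aemeasurable
    _ = ∫⁻ ω, ∫⁻ z', φ (ω, z') ∂Q ω.1 ∂π.prod Λ := by
        refine (lintegral_prod (fun ω : Z × (ℕ → unitInterval) => ∫⁻ z', φ (ω, z') ∂Q ω.1)
          (Measurable.aemeasurable ?_)).symm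
        exact Measurable.lintegral_kernel_prod_right' (κ := Q.comap Prod.fst measurable_fst) hφ

end Backward

/-! ### Existence by backward iteration -/

section Existence

variable {Z : Type*} {d : ℕ} {A : Z → Matrix (Fin d) (Fin d) ℝ}
  {b : Z → EuclideanSpace ℝ (Fin d)} {α : ℝ} {Ω : Type*}
  {z₀ : Ω → Z} {τ : Ω → Ω} {θ₀ : EuclideanSpace ℝ (Fin d)}

theorem lsaStep_sub_lsaStep (z : Z) (x y : EuclideanSpace ℝ (Fin d)) :
    lsaStep A b α z x - lsaStep A b α z y = lsaStep A 0 α z (x - y) := by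
  simp [lsaStep]

theorem continuous_lsaStep (z : Z) : Continuous (lsaStep A b α z) :=
  (act (1 - α • A z)).continuous.add continuous_const

/-- The iterate started from `θ₀` at time `-n` and driven by the past of `ω`. -/
noncomputable def backwardIterate (A : Z → Matrix (Fin d) (Fin d) ℝ)
    (b : Z → EuclideanSpace ℝ (Fin d)) (α : ℝ) (z₀ : Ω → Z) (τ : Ω → Ω)
    (θ₀ : EuclideanSpace ℝ (Fin d)) : ℕ → Ω → EuclideanSpace ℝ (Fin d)
  | 0, _ => θ₀
  | n + 1, ω => lsaStep A b α (z₀ ω) (backwardIterate A b α z₀ τ θ₀ n (τ ω))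

/-- Successive differences of the backward iterates. -/
noncomputable def backwardIncrement (A : Z → Matrix (Fin d) (Fin d) ℝ)
    (b : Z → EuclideanSpace ℝ (Fin d)) (α : ℝ) (z₀ : Ω → Z) (τ : Ω → Ω)
    (θ₀ : EuclideanSpace ℝ (Fin d)) (n : ℕ) (ω : Ω) : EuclideanSpace ℝ (Fin d) :=
  backwardIterate A b α z₀ τ θ₀ (n + 1) ω - backwardIterate A b α z₀ τ θ₀ n ω

theorem backwardIncrement_succ (n : ℕ) (ω : Ω) :
    backwardIncrement A b α z₀ τ θ₀ (n + 1) ω =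
      lsaStep A 0 α (z₀ ω) (backwardIncrement A b α z₀ τ θ₀ n (τ ω)) := by
  rw [backwardIncrement, backwardIncrement, ← lsaStep_sub_lsaStep]
  rfl

theorem sum_backwardIncrement (n : ℕ) (ω : Ω) :
    ∑ k ∈ Finset.range n, backwardIncrement A b α z₀ τ θ₀ k ω =
      backwardIterate A b α z₀ τ θ₀ n ω - θ₀ :=
  Finset.sum_range_sub (fun k => backwardIterate A b α z₀ τ θ₀ k ω) n

variable [MeasurableSpace Z] [MeasurableSpace Ω]

theorem measurable_lsaStep_comp (hA : ∀ i j, Measurable fun z => A z i j) (hb : Measurable b)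
    {X : Type*} [MeasurableSpace X] {ζ : X → Z} {θ : X → EuclideanSpace ℝ (Fin d)}
    (hζ : Measurable ζ) (hθ : Measurable θ) : Measurable fun x => lsaStep A b α (ζ x) (θ x) := by
  have h := (measurable_lsaStep A b α hA hb).comp (hζ.prodMk hθ)
  exact h

theorem measurable_backwardIterate (hA : ∀ i j, Measurable fun z => A z i j) (hb : Measurable b)
    (hz : Measurable z₀) (hτ : Measurable τ) (n : ℕ) :
    Measurable (backwardIterate A b α z₀ τ θ₀ n) := by
  induction n with
  | zero => exact measurable_const
  | succ n ih =>
    change Measurable fun ω =>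
      lsaStep A b α (z₀ ω) ((backwardIterate A b α z₀ τ θ₀ n ∘ τ) ω)
    exact measurable_lsaStep_comp hA hb hz (ih.comp hτ)

variable {Q : Kernel Z Z} [IsMarkovKernel Q] {m : Measure Ω}

/-- Pathwise, increment `n + 1` is a homogeneous step applied to increment `n` at `τ ω`. Given the
past, the state `z₀ ω` is drawn from `Q`, so in law this is one step of the homogeneous joint
kernel. -/
theorem lintegral_backwardIncrement (hA : ∀ i j, Measurable fun z => A z i j) (hb : Measurable b)
    (hz : Measurable z₀) (hτ : Measurable τ)
    (hm : ∀ φ : Ω × Z → ℝ≥0∞, Measurable φ →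
      ∫⁻ ω, φ (τ ω, z₀ ω) ∂m = ∫⁻ ω, ∫⁻ z', φ (ω, z') ∂Q (z₀ ω) ∂m)
    (n : ℕ) {ψ : EuclideanSpace ℝ (Fin d) × Z → ℝ≥0∞} (hψ : Measurable ψ) :
    ∫⁻ ω, ψ (backwardIncrement A b α z₀ τ θ₀ n ω, z₀ ω) ∂m =
      ∫⁻ ω, ∫⁻ w, ψ w ∂(jointKernel Q A 0 α ^ n)
        (backwardIncrement A b α z₀ τ θ₀ 0 ω, z₀ ω) ∂m := by
  induction n generalizing ψ with
  | zero => simp_rw [lintegral_pow_zero _ hψ]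
  | succ n ih =>
    have hD : Measurable (backwardIncrement A b α z₀ τ θ₀ n) :=
      (measurable_backwardIterate hA hb hz hτ _).sub (measurable_backwardIterate hA hb hz hτ _)
    have hφ : Measurable fun p : Ω × Z =>
        (lsaStep A 0 α p.2 (backwardIncrement A b α z₀ τ θ₀ n p.1), p.2) :=
      (measurable_lsaStep_comp hA measurable_zero measurable_snd
        (hD.comp measurable_fst)).prodMk measurable_snd
    have h1 := hm _ (hψ.comp hφ)
    simp only [Function.comp_apply] at h1
    simp_rw [lintegral_pow_add _ hψ, backwardIncrement_succ, pow_one]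
    rw [h1, ← ih hψ.lintegral_kernel]
    exact lintegral_congr fun ω =>
      (lintegral_jointKernel Q A 0 α hA measurable_zero ψ hψ _ _).symm

theorem measurePreserving_past
    (hτ : Measurable τ) (hm : ∀ φ : Ω × Z → ℝ≥0∞, Measurable φ →
      ∫⁻ ω, φ (τ ω, z₀ ω) ∂m = ∫⁻ ω, ∫⁻ z', φ (ω, z') ∂Q (z₀ ω) ∂m) :
    MeasurePreserving τ m m := by
  refine ⟨hτ, Measure.ext_of_lintegral _ fun φ hφ => ?_⟩
  rw [lintegral_map hφ hτ, hm (fun p => φ p.1) (hφ.comp measurable_fst)]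
  simp

/-- The invariant law is that of `(Θ, z₀)`, with `Θ` the almost sure limit of the backward iterates.
The sum of the increment norms has finite expectation, which gives both convergence and the moment
bound. -/
theorem exists_invariant_of_past [IsProbabilityMeasure m]
    (hA : ∀ i j, Measurable fun z => A z i j) (hb : Measurable b)
    (hz : Measurable z₀) (hτ : Measurable τ)
    (hm : ∀ φ : Ω × Z → ℝ≥0∞, Measurable φ →
      ∫⁻ ω, φ (τ ω, z₀ ω) ∂m = ∫⁻ ω, ∫⁻ z', φ (ω, z') ∂Q (z₀ ω) ∂m)
    {C : ℝ≥0∞} (hC : C ≠ ∞) (hcontr : ∀ (y : EuclideanSpace ℝ (Fin d)) (z : Z),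
      ∑' n, ∫⁻ w, ‖w.1‖ₑ ∂(jointKernel Q A 0 α ^ n) (y, z) ≤ C * ‖y‖ₑ)
    {B : ℝ≥0∞} (hB : B ≠ ∞) (hstart : ∀ z, ‖lsaStep A b α z θ₀ - θ₀‖ₑ ≤ B) :
    ∃ Pi : Measure (EuclideanSpace ℝ (Fin d) × Z), IsProbabilityMeasure Pi ∧
      Kernel.Invariant (jointKernel Q A b α) Pi ∧ ∫⁻ y, ‖y.1 - θ₀‖ₑ ∂Pi < ∞ := by
  set D := backwardIncrement A b α z₀ τ θ₀ with hDdef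
  set T := backwardIterate A b α z₀ τ θ₀ with hTdef
  have hTm : ∀ n, Measurable (T n) := measurable_backwardIterate hA hb hz hτ
  have hDm : ∀ n, Measurable (D n) := fun n => (hTm _).sub (hTm _)
  have hψ : Measurable fun w : EuclideanSpace ℝ (Fin d) × Z => ‖w.1‖ₑ := by fun_prop
  have hsum : ∫⁻ ω, ∑' n, ‖D n ω‖ₑ ∂m ≤ C * B := by
    rw [lintegral_tsum fun n => (hDm n).enorm.aemeasurable]
    calc ∑' n, ∫⁻ ω, ‖D n ω‖ₑ ∂m
        = ∑' n, ∫⁻ ω, ∫⁻ w, ‖w.1‖ₑ ∂(jointKernel Q A 0 α ^ n) (D 0 ω, z₀ ω) ∂m :=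
          tsum_congr fun n => lintegral_backwardIncrement hA hb hz hτ hm n hψ
      _ = ∫⁻ ω, ∑' n, ∫⁻ w, ‖w.1‖ₑ ∂(jointKernel Q A 0 α ^ n) (D 0 ω, z₀ ω) ∂m :=
          (lintegral_tsum fun n =>
            (hψ.lintegral_kernel.comp ((hDm 0).prodMk hz)).aemeasurable).symm
      _ ≤ ∫⁻ _, C * B ∂m := lintegral_mono fun ω => (hcontr _ _).trans (by
          gcongr; exact hstart (z₀ ω))
      _ = C * B := by simp
  have hae : ∀ᵐ ω ∂m, ∑' n, ‖D n ω‖ₑ < ∞ :=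
    ae_lt_top (Measurable.tsum fun n => (hDm n).enorm)
      (hsum.trans_lt (ENNReal.mul_lt_top hC.lt_top hB.lt_top)).ne
  have htend : ∀ ω, ∑' n, ‖D n ω‖ₑ < ∞ →
      Tendsto (fun n => T n ω) atTop (𝓝 (θ₀ + ∑' n, D n ω)) := by
    intro ω hω
    have h1 : Summable fun n => D n ω := (tsum_enorm_ne_top_iff_summable_norm.1 hω.ne).of_norm
    have h2 := h1.hasSum.tendsto_sum_nat.const_add θ₀
    simpa [hDdef, sum_backwardIncrement] using h2
  obtain ⟨Θ, hΘm, hΘ⟩ := exists_stronglyMeasurable_limit_of_tendsto_ae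
    (fun n => (hTm n).aestronglyMeasurable (μ := m)) (hae.mono fun ω hω => ⟨_, htend ω hω⟩)
  have hΘm := hΘm.measurable
  -- Pass to the limit in the recursion; convergence at `τ ω` holds almost surely because `τ`
  -- preserves `m`.
  have hfix : ∀ᵐ ω ∂m, lsaStep A b α (z₀ ω) (Θ (τ ω)) = Θ ω := by
    filter_upwards [hΘ, (measurePreserving_past hτ hm).quasiMeasurePreserving.ae hΘ] with ω h1 h2
    exact tendsto_nhds_unique (((continuous_lsaStep (z₀ ω)).tendsto _).comp h2)
      ((tendsto_add_atTop_iff_nat 1).2 h1)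
  have hpair : Measurable fun ω => (Θ ω, z₀ ω) := hΘm.prodMk hz
  refine ⟨m.map fun ω => (Θ ω, z₀ ω), Measure.isProbabilityMeasure_map hpair.aemeasurable,
    Measure.ext_of_lintegral _ fun f hf => ?_, ?_⟩
  · rw [Measure.lintegral_bind (Kernel.aemeasurable _) hf.aemeasurable,
      lintegral_map hf.lintegral_kernel hpair, lintegral_map hf hpair]
    calc ∫⁻ ω, ∫⁻ w, f w ∂jointKernel Q A b α (Θ ω, z₀ ω) ∂m
        = ∫⁻ ω, ∫⁻ z', f (lsaStep A b α z' (Θ ω), z') ∂Q (z₀ ω) ∂m :=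
          lintegral_congr fun ω => lintegral_jointKernel Q A b α hA hb f hf _ _
      _ = ∫⁻ ω, f (lsaStep A b α (z₀ ω) (Θ (τ ω)), z₀ ω) ∂m :=
          (hm (fun p => f (lsaStep A b α p.2 (Θ p.1), p.2))
            (hf.comp ((measurable_lsaStep_comp hA hb measurable_snd
              (hΘm.comp measurable_fst)).prodMk measurable_snd))).symm
      _ = ∫⁻ ω, f (Θ ω, z₀ ω) ∂m :=
          lintegral_congr_ae (hfix.mono fun ω hω => by simp only [hω])
  · rw [lintegral_map (by fun_prop) hpair]
    refine lt_of_le_of_lt (lintegral_mono_ae ?_)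
      (hsum.trans_lt (ENNReal.mul_lt_top hC.lt_top hB.lt_top))
    filter_upwards [hae, hΘ] with ω h1 h2
    rw [tendsto_nhds_unique h2 (htend ω h1), add_sub_cancel_left]
    exact enorm_tsum_le_tsum_enorm

end Existence

/-! ### Uniqueness by synchronous coupling -/

section Uniqueness

variable {Z : Type*} [MeasurableSpace Z] {d : ℕ} {A : Z → Matrix (Fin d) (Fin d) ℝ}
  {b : Z → EuclideanSpace ℝ (Fin d)} {α : ℝ} {Q : Kernel Z Z} [IsMarkovKernel Q]

theorem invariant_map_snd (hA : ∀ i j, Measurable fun z => A z i j) (hb : Measurable b)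
    {Pi : Measure (EuclideanSpace ℝ (Fin d) × Z)} (h : Kernel.Invariant (jointKernel Q A b α) Pi) :
    Kernel.Invariant Q (Pi.map Prod.snd) := by
  refine Measure.ext_of_lintegral _ fun f hf => ?_
  rw [Measure.lintegral_bind (Kernel.aemeasurable _) hf.aemeasurable,
    lintegral_map hf.lintegral_kernel measurable_snd, lintegral_map hf measurable_snd]
  conv_rhs => rw [← h.def]
  rw [Measure.lintegral_bind (f := fun w : EuclideanSpace ℝ (Fin d) × Z => f w.2) (Kernel.aemeasurable _)
    (hf.comp measurable_snd).aemeasurable]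
  exact lintegral_congr fun w =>
    (lintegral_jointKernel Q A b α hA hb _ (hf.comp measurable_snd) w.1 w.2).symm

theorem measurable_step_pair (hA : ∀ i j, Measurable fun z => A z i j) (hb : Measurable b)
    (θ : EuclideanSpace ℝ (Fin d)) : Measurable fun z => (lsaStep A b α z θ, z) :=
  (measurable_lsaStep_comp hA hb measurable_id measurable_const).prodMk measurable_id

theorem integral_jointKernel_pow_succ (hA : ∀ i j, Measurable fun z => A z i j)
    (hb : Measurable b) (n : ℕ) {f : EuclideanSpace ℝ (Fin d) × Z → ℝ} (hf : Measurable f)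
    {M : ℝ} (hM : ∀ w, |f w| ≤ M) (θ : EuclideanSpace ℝ (Fin d)) (z : Z) :
    ∫ w, f w ∂(jointKernel Q A b α ^ (n + 1)) (θ, z) =
      ∫ z', ∫ w, f w ∂(jointKernel Q A b α ^ n) (lsaStep A b α z' θ, z') ∂Q z := by
  have hmk : IsMarkovKernel (jointKernel Q A b α) := isMarkovKernel_jointKernel hA hb
  rw [pow_succ]
  change ∫ w, f w ∂((jointKernel Q A b α ^ n) ∘ₖ jointKernel Q A b α) (θ, z) = _
  rw [Kernel.integral_comp (Integrable.of_bound hf.aestronglyMeasurable M (ae_of_all _ hM)),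
    jointKernel_apply Q A b α hA hb, integral_map]
  · exact (measurable_step_pair hA hb θ).aemeasurable
  · exact hf.stronglyMeasurable.integral_kernel.aestronglyMeasurable

/-- Both chains use the same noise, so `b` cancels and their difference follows the homogeneous
recursion started from `x - y`. -/
theorem enorm_integral_pow_sub_le (hA : ∀ i j, Measurable fun z => A z i j)
    (hb : Measurable b) {f : EuclideanSpace ℝ (Fin d) × Z → ℝ} (hf : Measurable f)
    {M : ℝ} (hM : ∀ w, |f w| ≤ M) {c : ℝ≥0∞}
    (hLip : ∀ x y z, ‖f (x, z) - f (y, z)‖ₑ ≤ c * ‖x - y‖ₑ) (n : ℕ)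
    (x y : EuclideanSpace ℝ (Fin d)) (z : Z) :
    ‖∫ w, f w ∂(jointKernel Q A b α ^ n) (x, z) - ∫ w, f w ∂(jointKernel Q A b α ^ n) (y, z)‖ₑ ≤
      c * ∫⁻ w, ‖w.1‖ₑ ∂(jointKernel Q A 0 α ^ n) (x - y, z) := by
  have hmk : IsMarkovKernel (jointKernel Q A b α) := isMarkovKernel_jointKernel hA hb
  have hψ : Measurable fun w : EuclideanSpace ℝ (Fin d) × Z => ‖w.1‖ₑ := by fun_prop
  induction n generalizing x y z with
  | zero =>
    rw [lintegral_pow_zero _ hψ, pow_zero]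
    change ‖∫ w, f w ∂Kernel.id (x, z) - ∫ w, f w ∂Kernel.id (y, z)‖ₑ ≤ _
    rw [Kernel.id_apply, Kernel.id_apply, integral_dirac' _ _ hf.stronglyMeasurable,
      integral_dirac' _ _ hf.stronglyMeasurable]
    exact hLip x y z
  | succ n ih =>
    have hint : ∀ θ, Integrable (fun z' => ∫ w, f w ∂(jointKernel Q A b α ^ n)
        (lsaStep A b α z' θ, z')) (Q z) := by
      intro θ
      refine Integrable.of_bound (hf.stronglyMeasurable.integral_kernel.comp_measurable
        (measurable_step_pair hA hb θ)).aestronglyMeasurable M (ae_of_all _ fun z' => ?_)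
      simpa using abs_integral_le_of_abs_le
        ((jointKernel Q A b α ^ n) (lsaStep A b α z' θ, z')) hM
    have hmz : Measurable fun z' => ∫⁻ w, ‖w.1‖ₑ ∂(jointKernel Q A 0 α ^ n)
        (lsaStep A 0 α z' (x - y), z') :=
      hψ.lintegral_kernel.comp (measurable_step_pair hA measurable_zero _)
    rw [integral_jointKernel_pow_succ hA hb n hf hM, integral_jointKernel_pow_succ hA hb n hf hM,
      ← integral_sub (hint x) (hint y), lintegral_jointKernel_pow_succ hA measurable_zero n hψ,
      ← lintegral_const_mul _ hmz]
    refine (enorm_integral_le_lintegral_enorm _).trans (lintegral_mono fun z' => ?_)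
    refine (ih _ _ z').trans_eq ?_
    rw [lsaStep_sub_lsaStep]

/-- The limit is determined by quantities in which `Pi` appears only through its noise marginal.
Since `f` is bounded, dominated convergence applies without any moment of `Pi`, so uniqueness holds
among all invariant probability measures. -/
theorem tendsto_integral_pow_sub (hA : ∀ i j, Measurable fun z => A z i j)
    (hb : Measurable b) {C : ℝ≥0∞} (hC : C ≠ ∞)
    (hcontr : ∀ (y : EuclideanSpace ℝ (Fin d)) (z : Z),
      ∑' n, ∫⁻ w, ‖w.1‖ₑ ∂(jointKernel Q A 0 α ^ n) (y, z) ≤ C * ‖y‖ₑ)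
    {f : EuclideanSpace ℝ (Fin d) × Z → ℝ} (hf : Measurable f)
    {M : ℝ} (hM : ∀ w, |f w| ≤ M) {c : ℝ≥0∞} (hc : c ≠ ∞)
    (hLip : ∀ x y z, ‖f (x, z) - f (y, z)‖ₑ ≤ c * ‖x - y‖ₑ)
    {π : Measure Z} {Pi : Measure (EuclideanSpace ℝ (Fin d) × Z)} [IsProbabilityMeasure Pi]
    (hPi : Kernel.Invariant (jointKernel Q A b α) Pi) (hπ : Pi.map Prod.snd = π) :
    Tendsto (fun n => ∫ z, ∫ w, f w ∂(jointKernel Q A b α ^ n) (0, z) ∂π) atTop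
      (𝓝 (∫ w, f w ∂Pi)) := by
  have hmk : IsMarkovKernel (jointKernel Q A b α) := isMarkovKernel_jointKernel hA hb
  have hm1 : ∀ n, Measurable fun v : EuclideanSpace ℝ (Fin d) × Z =>
      ∫ w, f w ∂(jointKernel Q A b α ^ n) v := fun n =>
    hf.stronglyMeasurable.integral_kernel.measurable
  have hm2 : ∀ n, Measurable fun v : EuclideanSpace ℝ (Fin d) × Z =>
      ∫ w, f w ∂(jointKernel Q A b α ^ n) (0, v.2) := fun n =>
    (hm1 n).comp (measurable_const.prodMk measurable_snd)
  have hbd : ∀ n v, |∫ w, f w ∂(jointKernel Q A b α ^ n) v| ≤ M := fun n v => by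
    simpa using abs_integral_le_of_abs_le ((jointKernel Q A b α ^ n) v) hM
  have hdiff : Tendsto (fun n => ∫ v, (∫ w, f w ∂(jointKernel Q A b α ^ n) (0, v.2) -
      ∫ w, f w ∂(jointKernel Q A b α ^ n) v) ∂Pi) atTop (𝓝 (∫ _, (0 : ℝ) ∂Pi)) := by
    refine tendsto_integral_of_dominated_convergence (fun _ => M + M)
      (fun n => ((hm2 n).sub (hm1 n)).aestronglyMeasurable) (integrable_const _)
      (fun n => ae_of_all _ fun v => ?_) (ae_of_all _ fun v => ?_)
    · exact (abs_sub _ _).trans (add_le_add (hbd n _) (hbd n _))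
    · have h1 : Tendsto (fun n => c * ∫⁻ w, ‖w.1‖ₑ ∂(jointKernel Q A 0 α ^ n) (0 - v.1, v.2))
          atTop (𝓝 (c * 0)) := by
        refine ENNReal.Tendsto.const_mul ?_ (Or.inr hc)
        refine ENNReal.tendsto_atTop_zero_of_tsum_ne_top ?_
        exact ((hcontr _ _).trans_lt (ENNReal.mul_lt_top hC.lt_top enorm_lt_top)).ne
      rw [mul_zero] at h1
      rw [tendsto_iff_enorm_sub_tendsto_zero]
      refine tendsto_of_tendsto_of_tendsto_of_le_of_le tendsto_const_nhds h1
        (fun _ => zero_le) fun n => ?_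
      simp only [sub_zero]
      exact enorm_integral_pow_sub_le hA hb hf hM hLip n 0 v.1 v.2
  have hint : Integrable f Pi :=
    Integrable.of_bound hf.aestronglyMeasurable M (ae_of_all _ hM)
  have heq : ∀ n, ∫ v, (∫ w, f w ∂(jointKernel Q A b α ^ n) (0, v.2) -
      ∫ w, f w ∂(jointKernel Q A b α ^ n) v) ∂Pi =
      ∫ z, ∫ w, f w ∂(jointKernel Q A b α ^ n) (0, z) ∂π - ∫ w, f w ∂Pi := by
    intro n
    have hm3 : Measurable fun z => ∫ w, f w ∂(jointKernel Q A b α ^ n) (0, z) :=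
      (hm1 n).comp (measurable_const.prodMk measurable_id)
    rw [integral_sub (Integrable.of_bound (hm2 n).aestronglyMeasurable M
      (ae_of_all _ fun v => hbd n _)) (Integrable.of_bound (hm1 n).aestronglyMeasurable M
      (ae_of_all _ fun v => hbd n _)), ← integral_eq_of_invariant (invariant_pow hPi n) hint, ← hπ,
      integral_map measurable_snd.aemeasurable hm3.aestronglyMeasurable]
  simp_rw [heq, integral_zero] at hdiff
  simpa using hdiff.add_const (∫ w, f w ∂Pi)

theorem invariant_jointKernel_unique (hA : ∀ i j, Measurable fun z => A z i j)
    (hb : Measurable b) {C : ℝ≥0∞} (hC : C ≠ ∞)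
    (hcontr : ∀ (y : EuclideanSpace ℝ (Fin d)) (z : Z),
      ∑' n, ∫⁻ w, ‖w.1‖ₑ ∂(jointKernel Q A 0 α ^ n) (y, z) ≤ C * ‖y‖ₑ)
    {Pi Pi' : Measure (EuclideanSpace ℝ (Fin d) × Z)} [IsProbabilityMeasure Pi]
    [IsProbabilityMeasure Pi'] (hPi : Kernel.Invariant (jointKernel Q A b α) Pi)
    (hPi' : Kernel.Invariant (jointKernel Q A b α) Pi')
    (hsnd : Pi'.map Prod.snd = Pi.map Prod.snd) : Pi' = Pi := by
  -- Regularity of test functions is needed only in `θ`: approximate the indicator of `F` by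
  -- Lipschitz thickened indicators and keep that of `B` as it is. Closed-by-measurable rectangles
  -- form a generating π-system.
  have key : ∀ (F : Set (EuclideanSpace ℝ (Fin d))), IsClosed F → ∀ B : Set Z, MeasurableSet B →
      Pi' (F ×ˢ B) = Pi (F ×ˢ B) := by
    intro F hF B hB
    have hδ : ∀ n : ℕ, (0 : ℝ) < 1 / ((n : ℝ) + 1) := fun n => by positivity
    set f : ℕ → EuclideanSpace ℝ (Fin d) × Z → ℝ := fun n w =>
      (thickenedIndicator (hδ n) F w.1 : ℝ) * B.indicator 1 w.2 with hf
    have hfm : ∀ n, Measurable (f n) := fun n =>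
      ((NNReal.continuous_coe.comp (thickenedIndicator (hδ n) F).continuous).measurable.comp
        measurable_fst).mul ((measurable_one.indicator hB).comp measurable_snd)
    have hB1 : ∀ z, |B.indicator (1 : Z → ℝ) z| ≤ 1 := fun z => by
      by_cases h : z ∈ B <;> simp [h]
    have hfM : ∀ n w, |f n w| ≤ 1 := by
      intro n w
      rw [hf, abs_mul]
      refine mul_le_one₀ ?_ (abs_nonneg _) (hB1 _)
      rw [NNReal.abs_eq]
      exact_mod_cast thickenedIndicator_le_one (hδ n) F w.1
    have hLip : ∀ n x y z, ‖f n (x, z) - f n (y, z)‖ₑ ≤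
        ((1 / ((n : ℝ) + 1)).toNNReal⁻¹ : NNReal) * ‖x - y‖ₑ := by
      intro n x y z
      have h1 := lipschitzWith_thickenedIndicator (hδ n) F x y
      have h2 : f n (x, z) - f n (y, z) = ((thickenedIndicator (hδ n) F x : ℝ) -
          (thickenedIndicator (hδ n) F y : ℝ)) * B.indicator 1 z := by
        simp only [hf]; ring
      rw [h2, enorm_mul]
      have h3 : ‖B.indicator (1 : Z → ℝ) z‖ₑ ≤ 1 := by
        rw [← ofReal_norm]
        exact ENNReal.ofReal_le_one.2 (hB1 z)
      refine (mul_le_of_le_one_right zero_le h3).trans ?_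
      rw [← edist_eq_enorm_sub, ← edist_eq_enorm_sub]
      exact h1
    have heq : ∀ n, ∫ w, f n w ∂Pi' = ∫ w, f n w ∂Pi := fun n =>
      tendsto_nhds_unique
        (tendsto_integral_pow_sub hA hb hC hcontr (hfm n) (hfM n) ENNReal.coe_ne_top (hLip n)
          hPi' hsnd)
        (tendsto_integral_pow_sub hA hb hC hcontr (hfm n) (hfM n) ENNReal.coe_ne_top (hLip n)
          hPi rfl)
    have hlim : ∀ (ν : Measure (EuclideanSpace ℝ (Fin d) × Z)) [IsProbabilityMeasure ν],
        Tendsto (fun n => ∫ w, f n w ∂ν) atTop (𝓝 (ν.real (F ×ˢ B))) := by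
      intro ν _
      rw [← integral_indicator_one (hF.measurableSet.prod hB)]
      refine tendsto_integral_of_dominated_convergence (fun _ => 1)
        (fun n => (hfm n).aestronglyMeasurable) (integrable_const _)
        (fun n => ae_of_all _ (hfM n)) (ae_of_all _ fun w => ?_)
      have h1 := tendsto_pi_nhds.1 (thickenedIndicator_tendsto_indicator_closure hδ
        tendsto_one_div_add_atTop_nhds_zero_nat F) w.1
      have h2 := ((NNReal.continuous_coe.tendsto _).comp h1).mul_const (B.indicator 1 w.2)
      rw [hF.closure_eq] at h2
      have h3 : (F ×ˢ B).indicator (1 : EuclideanSpace ℝ (Fin d) × Z → ℝ) w =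
          ((F.indicator (fun _ => 1) w.1 : NNReal) : ℝ) * B.indicator 1 w.2 := by
        by_cases hw : w.1 ∈ F <;> by_cases hw2 : w.2 ∈ B <;> simp [Set.indicator, hw, hw2]
      rw [h3]
      exact h2
    have h := tendsto_nhds_unique (hlim Pi') ((hlim Pi).congr fun n => (heq n).symm)
    exact (measureReal_eq_measureReal_iff).1 h
  refine ext_of_generate_finite (Set.image2 (· ×ˢ ·) {F | IsClosed F} {B | MeasurableSet B})
    ?_ ?_ ?_ (by simp)
  · refine (generateFrom_eq_prod (C := {F : Set (EuclideanSpace ℝ (Fin d)) | IsClosed F})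
      (D := {B : Set Z | MeasurableSet B}) ?_ MeasurableSpace.generateFrom_measurableSet
      ⟨fun _ => Set.univ, fun _ => isClosed_univ, Set.iUnion_const _⟩
      isCountablySpanning_measurableSet).symm
    rw [← borel_eq_generateFrom_isClosed]
    exact BorelSpace.measurable_eq.symm
  · exact isPiSystem_isClosed.prod MeasurableSpace.isPiSystem_measurableSet
  · rintro _ ⟨F, hF, B, hB, rfl⟩
    exact key F hF B hB

end Uniqueness

/-! ### Constants and step size -/

section Constants

variable {Z : Type*} {d : ℕ} {A : Z → Matrix (Fin d) (Fin d) ℝ} {Abar : Matrix (Fin d) (Fin d) ℝ}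

theorem inner_act_eq_sum (M : Matrix (Fin d) (Fin d) ℝ) (x y : EuclideanSpace ℝ (Fin d)) :
    inner ℝ x (act M y) = ∑ i, ∑ j, x i * (M i j * y j) := by
  rw [act, Matrix.inner_toEuclideanCLM]
  simp [dotProduct, Matrix.mulVec, Finset.mul_sum]

theorem abs_apply_le_opNorm (M : Matrix (Fin d) (Fin d) ℝ) (i j : Fin d) :
    |M i j| ≤ opNorm M := by
  have h : M i j = inner ℝ (EuclideanSpace.single i (1 : ℝ))
      (act M (EuclideanSpace.single j (1 : ℝ))) := by
    rw [inner_act_eq_sum]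
    simp
  rw [h]
  refine (abs_real_inner_le_norm _ _).trans ?_
  simpa using norm_act_le M (EuclideanSpace.single j (1 : ℝ))

theorem integral_inner_act_eq [MeasurableSpace Z] {π : Measure Z} [IsFiniteMeasure π]
    (hA : ∀ i j, Measurable fun z => A z i j) {C : ℝ} (hC : ∀ z, opNorm (A z) ≤ C)
    (hAmean : ∀ i j, ∫ z, A z i j ∂π = Abar i j) (x y : EuclideanSpace ℝ (Fin d)) :
    ∫ z, inner ℝ x (act (A z) y) ∂π = inner ℝ x (act Abar y) := by
  have hint : ∀ i j, Integrable (fun z => A z i j) π := fun i j =>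
    Integrable.of_bound (hA i j).aestronglyMeasurable C
      (ae_of_all _ fun z => (abs_apply_le_opNorm (A z) i j).trans (hC z))
  have hint' : ∀ i j, Integrable (fun z => x i * (A z i j * y j)) π := fun i j =>
    ((hint i j).mul_const _).const_mul _
  simp_rw [inner_act_eq_sum]
  rw [integral_finsetSum _ fun i _ => integrable_finsetSum _ fun j _ => hint' i j]
  refine Finset.sum_congr rfl fun i _ => ?_
  rw [integral_finsetSum _ fun j _ => hint' i j]
  refine Finset.sum_congr rfl fun j _ => ?_
  rw [integral_const_mul, integral_mul_const, hAmean]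

theorem opNorm_le_boundA (h : BddAbove (Set.range fun z => opNorm (A z))) (z : Z) :
    opNorm (A z) ≤ boundA A Abar :=
  (le_ciSup h z).trans (le_max_left _ _)

theorem opNorm_pos_of_posDef [NeZero d] {P : Matrix (Fin d) (Fin d) ℝ} (hP : P.PosDef) :
    0 < opNorm P := by
  refine (norm_nonneg _).lt_of_ne fun h => ?_
  have h1 := hP.diag_pos (i := (0 : Fin d))
  have h2 := abs_apply_le_opNorm P 0 0
  rw [opNorm, ← h] at h2
  exact h1.ne' (abs_nonpos_iff.1 h2)

theorem lsaStep_sub_eq_smul_noise {b : Z → EuclideanSpace ℝ (Fin d)} {α : ℝ}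
    {bbar θstar : EuclideanSpace ℝ (Fin d)} (hθstar : act Abar θstar = bbar) (z : Z) :
    lsaStep A b α z θstar - θstar = -(α • noise A b Abar bbar θstar z) := by
  have h1 : act (A z - Abar) θstar = act (A z) θstar - bbar := by
    rw [← hθstar]; simp [act]
  have h2 : act (1 - α • A z) θstar = θstar - α • act (A z) θstar := by simp [act]
  rw [lsaStep, noise, h1, h2]
  module

/-- Here `96 = 12 · 4 · 2`: the 12 in the step size bound, the 4 in `constGamma`, and `q ≥ 2`;
moreover `K² ≤ (K + a/6)²`. -/
theorem stepSize_bound {t : ℕ} (ht : 1 ≤ t) {C q α : ℝ} (hC : 0 ≤ C) (ha : 0 < aConst Abar)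
    (hN : 0 < blockCount Abar C) (hq : 2 ≤ q) (hα : 0 < α)
    (hα' : α < min (alphaQInfM Abar C q) (aConst Abar)⁻¹ * (t : ℝ)⁻¹) :
    96 * (((blockCount Abar C * t : ℕ) * α) * (√(kappaQ Abar) * C) ^ 2) ≤ aConst Abar := by
  set N := blockCount Abar C with hNdef
  set K := √(kappaQ Abar) * C with hK
  set a := aConst Abar with hadef
  have hK0 : 0 ≤ K := by positivity
  have ht0 : (0 : ℝ) < t := by exact_mod_cast ht
  have hN0 : (0 : ℝ) < N := by exact_mod_cast hN
  have hG : constGamma Abar C = 4 * (K + a / 6) ^ 2 * N := rfl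
  have hG0 : 0 < constGamma Abar C := by rw [hG]; positivity
  have h1 : α * t ≤ a / (12 * constGamma Abar C) / q := by
    rw [← div_eq_mul_inv, lt_div_iff₀ ht0] at hα'
    exact hα'.le.trans ((min_le_left _ _).trans (min_le_right _ _))
  rw [div_div, le_div_iff₀ (by positivity), hG] at h1
  have h2 : K ^ 2 ≤ (K + a / 6) ^ 2 := pow_le_pow_left₀ hK0 (by linarith) 2
  push_cast
  calc 96 * (N * t * α * K ^ 2) = α * t * (12 * (4 * K ^ 2 * N) * 2) := by ring
    _ ≤ α * t * (12 * (4 * (K + a / 6) ^ 2 * N) * q) := by gcongr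
    _ ≤ a := h1

end Constants

end LSA

/-! ### The theorem -/

theorem mainTheorem3
    {Z : Type*} [TopologicalSpace Z] [PolishSpace Z] [MeasurableSpace Z] [BorelSpace Z]
    (d : ℕ) (hd : 1 ≤ d)
    -- the noise chain: Markov kernel, invariant distribution, uniform geometric ergodicity
    (Q : Kernel Z Z) [IsMarkovKernel Q]
    (π : Measure Z) [IsProbabilityMeasure π] (hπ : Kernel.Invariant Q π)
    (tmix : ℕ) (htmix : 1 ≤ tmix)
    (hmix : ∀ k : ℕ, 1 ≤ k → LSA.dobrushin (Q ^ k) ≤ (1 / 4 : ℝ≥0∞) ^ (k / tmix))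
    -- the linear system
    (A : Z → Matrix (Fin d) (Fin d) ℝ) (hA : ∀ i j, Measurable fun z => A z i j)
    (b : Z → EuclideanSpace ℝ (Fin d)) (hb : Measurable b)
    (Abar : Matrix (Fin d) (Fin d) ℝ) (bbar θstar : EuclideanSpace ℝ (Fin d))
    (hθstar : LSA.act Abar θstar = bbar)
    (hAbdd : BddAbove (Set.range fun z => LSA.opNorm (A z)))
    (hAbdd' : BddAbove (Set.range fun z => LSA.opNorm (A z - Abar)))
    (hHurwitz : LSA.IsHurwitz (-Abar))
    (hAmean : ∀ i j, ∫ z, A z i j ∂π = Abar i j)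
    (hbmean : ∫ z, b z ∂π = bbar)
    (hnoise : BddAbove (Set.range fun z => ‖LSA.noise A b Abar bbar θstar z‖))
    -- the step size
    (q : ℝ) (hq : 2 ≤ q)
    (α : ℝ) (hα : 0 < α)
    (hα' : α < min (LSA.alphaQInfM Abar (LSA.boundA A Abar) q) (LSA.aConst Abar)⁻¹ *
      (tmix : ℝ)⁻¹) :
    ∃ Pi : Measure (EuclideanSpace ℝ (Fin d) × Z),
      (IsProbabilityMeasure Pi ∧ Kernel.Invariant (LSA.jointKernel Q A b α) Pi) ∧
      (∀ Pi' : Measure (EuclideanSpace ℝ (Fin d) × Z),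
        IsProbabilityMeasure Pi' → Kernel.Invariant (LSA.jointKernel Q A b α) Pi' → Pi' = Pi) ∧
      ∫⁻ y, ENNReal.ofReal ‖y.1 - θstar‖ ∂Pi < ∞ := by
  have : NeZero d := ⟨by omega⟩
  obtain ⟨z₁⟩ : Nonempty Z := π.nonempty_of_neZero
  obtain ⟨hP, hlyap⟩ := LSA.lyapunovMatrix_spec Abar hHurwitz
  obtain ⟨R, hR⟩ := LSA.exists_factor hP.posSemidef
  set C := LSA.boundA A Abar with hCdef
  set a := LSA.aConst Abar with hadef
  set K := √(LSA.kappaQ Abar) * C with hKdef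
  have hCz : ∀ z, LSA.opNorm (A z) ≤ C := LSA.opNorm_le_boundA hAbdd
  have hC0 : 0 ≤ C := (norm_nonneg _).trans (hCz z₁)
  have hK : ∀ z x, ‖R (LSA.act (A z) x)‖ ≤ K * ‖R x‖ := fun z x =>
    (LSA.norm_factor_act_le hP hR (A z) x).trans (by
      rw [hKdef, LSA.kappaQ]; gcongr; exact hCz z)
  have ha : 0 < a := by
    have := LSA.opNorm_pos_of_posDef hP
    rw [hadef, LSA.aConst]; positivity
  have hdrift : ∀ y, a * ‖R y‖ ^ 2 ≤ ∫ x, inner ℝ (R y) (R (LSA.act (A x) y)) ∂π := by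
    intro y
    -- Move the weight onto the fixed vector `y`, so that the integrand is a plain bilinear form in
    -- `A x` and the mean of `A` can be inserted.
    have h1 : ∀ u, inner ℝ (R y) (R u) = inner ℝ
        (LSA.act (LSA.lyapunovMatrix Abar)ᵀ y) u := fun u => by
      rw [hR, ← LSA.inner_act_transpose, Matrix.transpose_transpose]
    simp_rw [h1]
    rw [LSA.integral_inner_act_eq hA hCz hAmean, ← h1]
    exact LSA.mul_norm_factor_sq_le hlyap hR y
  have hRle := LSA.norm_le_mul_norm_factor hP hR
  -- Compare the lower and upper bounds for the drift at any nonzero vector.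
  have haK : a ≤ K := by
    obtain ⟨y, hy⟩ := exists_ne (0 : EuclideanSpace ℝ (Fin d))
    have h1 : 0 < ‖R y‖ := by
      refine (norm_nonneg _).lt_of_ne fun h => hy (norm_le_zero_iff.1 ?_)
      have := hRle y
      rwa [← h, mul_zero] at this
    have h2 := (hdrift y).trans ((le_abs_self _).trans (LSA.abs_integral_inner_act_le hK y π))
    exact le_of_mul_le_mul_right h2 (by positivity)
  set N := LSA.blockCount Abar C with hNdef
  have hceil : 8 * √(LSA.kappaQ Abar) * C / a ≤ N := Nat.le_ceil _
  have hN : 8 * K ≤ a * N := by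
    rw [div_le_iff₀ ha] at hceil
    rw [hKdef]; linarith
  have hN0 : 0 < N := by
    rw [← Nat.cast_pos (α := ℝ)]
    exact pos_of_mul_pos_right (lt_of_lt_of_le (by linarith) hN) ha.le
  obtain ⟨C', hC', hcontr⟩ := LSA.exists_tsum_lintegral_enorm_le hπ htmix hmix hA hα ha haK hK
    hdrift hN (LSA.stepSize_bound htmix hC0 ha hN0 hq hα hα') hRle
  obtain ⟨m, z₀, τ, hm, hz, hτ, hpast⟩ := LSA.exists_stationary_past hπ
  obtain ⟨B, hB⟩ := hnoise
  -- Starting at `θ⋆` makes the first increment equal to `-α ε(z)`, bounded uniformly in `z`.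
  have hstart : ∀ z, ‖LSA.lsaStep A b α z θstar - θstar‖ₑ ≤ ENNReal.ofReal (α * B) := by
    intro z
    rw [LSA.lsaStep_sub_eq_smul_noise hθstar, enorm_neg, ← ofReal_norm, norm_smul,
      Real.norm_of_nonneg hα.le]
    exact ENNReal.ofReal_le_ofReal (mul_le_mul_of_nonneg_left (hB ⟨z, rfl⟩) hα.le)
  obtain ⟨Pi, hPi, hinv, hmom⟩ := LSA.exists_invariant_of_past hA hb hz hτ hpast hC' hcontr
    ENNReal.ofReal_ne_top hstart
  have hsnd : ∀ (ν : Measure (EuclideanSpace ℝ (Fin d) × Z)) [IsProbabilityMeasure ν],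
      Kernel.Invariant (LSA.jointKernel Q A b α) ν → ν.map Prod.snd = π := fun ν _ hν =>
    have : IsProbabilityMeasure (ν.map Prod.snd) :=
      Measure.isProbabilityMeasure_map measurable_snd.aemeasurable
    LSA.invariant_unique hπ htmix hmix (LSA.invariant_map_snd hA hb hν)
  refine ⟨Pi, ⟨hPi, hinv⟩, fun Pi' hPi' hinv' => ?_, by simpa only [ofReal_norm] using hmom⟩
  exact LSA.invariant_jointKernel_unique hA hb hC' hcontr hinv hinv'
    ((hsnd Pi' hinv').trans (hsnd Pi hinv).symm)
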